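/- Let $K=\mathbb{Q}(\sqrt5)$ with algebraic conjugation $'$ (given by $\sqrt5\mapsto-\sqrt5$), let $\tau=(1+\sqrt5)/2$ and $\mathfrak{o}=\mathbb{Z}[\tau]$. Let $\mathbb{H}(K)\subset\mathbb{H}(\mathbb{R})=\mathbb{R}^4$ be the Hamilton quaternions over $K$, written $(a,b,c,d)=a+\mathrm{i}b+\mathrm{j}c+\mathrm{k}d$, with reduced norm $\mathrm{nr}(q)=q\bar q=|q|^2$ and twist map $\widetilde{(a,b,c,d)}=(a',b',d',c')$. Let the icosian ring $\mathbb{I}$ be the $\mathfrak{o}$-span of $(1,0,0,0)$, $(0,1,0,0)$, $\tfrac12(1,1,1,1)$, $\tfrac12(1-\tau,\tau,0,1)$; the norms $\mathrm{nr}(q)$, $q\in\mathbb{I}$, lie in $\mathfrak{o}$. Let $$L=\bigl\langle(1,0,0,0),\ \tfrac12(-1,1,1,1),\ (0,-1,0,0),\ \tfrac12(0,1,\tau-1,-\tau)\bigr\rangle_{\mathbb{Z}}\subset\mathbb{R}^4,$$ a copy of the root lattice $A_4$. An icosian $q$ is called primitive if $\alpha q\in\mathbb{I}$ with $\alpha\in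 K$ implies $\alpha\in\mathfrak{o}$, and admissible if $|q\tilde q|\in\mathbb{N}$. For a linear isometry $R$ of $\mathbb{R}^4$ put $\Sigma(R)=[L:L\cap RL]$; $R$ is a coincidence isometry of $L$ if $\Sigma(R)<\infty$. Theorem. Let $q\in\mathbb{I}$ be primitive and admissible. Then: 1. The map $R_q\colon x\mapsto\frac{1}{|q\tilde q|}\,q x\tilde q$ is a rotation of $\mathbb{R}^4$ (a linear isometry of determinant $1$) and a coincidence isometry of $L$. 2. Among the least common multiples of $\mathrm{nr}(q)$ and $\mathrm{nr}(q)'$ in $\mathfrak{o}$ (which are determined up to units of $\mathfrak{o}$) there is exactly one natural number; denote it by $\mathrm{lcm}(\mathrm{nr}(q),\mathrm{nr}(q)')$. With this choice, $\alpha_q=\sqrt{\mathrm{lcm}(\mathrm{nr}(q),\mathrm{nr}(q)')/\mathrm{nr}(q)}$ lies in $\mathfrak{o}$. 3. With $q_\alpha=\alpha_q q$, the coincidence index of $R_q$ is $$\Sigma(q):=\Sigma(R_q)=\mathrm{nr}(q_\alpha)=\mathrm{lcm}(\mathrm{nr}(q),\mathrm{nr}(q)')\in\mathbb{N}.$$ 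-/

import Mathlib

open scoped Quaternion goldenRatio

namespace Icosian

/-! ### Coincidence isometries of a lattice -/

section Coincidence

variable {E : Type*} [NormedAddCommGroup E] [InnerProductSpace ℝ E]

/-- The coincidence site lattice `Γ ∩ RΓ`. -/
def csl (Γ : AddSubgroup E) (R : E ≃ₗᵢ[ℝ] E) : AddSubgroup E :=
  Γ ⊓ Γ.map (R : E →+ E)

/-- `R` is a coincidence isometry of `Γ`: the index `[Γ : Γ ∩ RΓ]` is finite. -/
def IsCoincidenceIsometry (Γ : AddSubgroup E) (R : E ≃ₗᵢ[ℝ] E) : Prop :=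
  (csl Γ R).IsFiniteRelIndex Γ

/-- The coincidence index `Σ(R) = [Γ : Γ ∩ RΓ]` (with value `0` if this index is infinite). -/
noncomputable def coincidenceIndex (Γ : AddSubgroup E) (R : E ≃ₗᵢ[ℝ] E) : ℕ :=
  (csl Γ R).relIndex Γ

end Coincidence

/-! ### The field `ℚ(√5)` and its ring of integers `ℤ[τ]` -/

/-- The field `K = ℚ(√5)`: the element `⟨q, r⟩` is `q + r √5`. -/
abbrev K : Type := QuadraticAlgebra ℚ 5 0

/-- The algebraic conjugation `√5 ↦ -√5` of `K`. -/
def conjK (x : K) : K := ⟨x.re, -x.im⟩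

/-- The embedding `q + r √5 ↦ q + r √5` of `K` into the real numbers. -/
noncomputable def toReal (x : K) : ℝ := (x.re : ℝ) + (x.im : ℝ) * √5

/-- The golden ratio `τ = (1 + √5) / 2`, as an element of `K`. -/
def tau : K := ⟨1 / 2, 1 / 2⟩

theorem tau_mul_tau : tau * tau = tau + 1 := by
  ext <;> simp [tau, QuadraticAlgebra.re_one, QuadraticAlgebra.im_one] <;> norm_num

/-- The ring `ℤ[τ] = {m + n τ ∣ m, n ∈ ℤ}`. -/
def o : Subring K where
  carrier := {x | ∃ m n : ℤ, x = (m : K) + (n : K) * tau}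
  zero_mem' := ⟨0, 0, by simp⟩
  one_mem' := ⟨1, 0, by simp⟩
  add_mem' := by
    rintro _ _ ⟨a, b, rfl⟩ ⟨c, d, rfl⟩
    exact ⟨a + c, b + d, by push_cast; ring⟩
  neg_mem' := by
    rintro _ ⟨a, b, rfl⟩
    exact ⟨-a, -b, by push_cast; ring⟩
  mul_mem' := by
    rintro _ _ ⟨a, b, rfl⟩ ⟨c, d, rfl⟩
    refine ⟨a * c + b * d, a * d + b * c + b * d, ?_⟩
    push_cast
    linear_combination ((b : K) * d) * tau_mul_tau

theorem tau_mem : tau ∈ o := ⟨0, 1, by simp⟩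

theorem conjK_mem {x : K} (hx : x ∈ o) : conjK x ∈ o := by
  obtain ⟨m, n, rfl⟩ := hx
  refine ⟨m + n, -n, ?_⟩
  ext <;> simp [conjK, tau]
  ring

/-- The algebraic conjugation on `ℤ[τ]`. -/
def conjO (x : o) : o := ⟨conjK x, conjK_mem x.2⟩

/-- `m` is a least common multiple of `a` and `b`. It is unique up to units only. -/
def IsLcm {R : Type*} [CommRing R] (a b m : R) : Prop :=
  a ∣ m ∧ b ∣ m ∧ ∀ c : R, a ∣ c → b ∣ c → m ∣ c

/-! ### Quaternions over `K` and the icosian ring -/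

/-- The quaternion `(a, b, c, d) = a + i b + j c + k d`. -/
def quat {R : Type*} [CommRing R] (a b c d : R) : ℍ[R] := ⟨a, b, c, d⟩

/-- The inclusion of `ℍ(K)` into Hamilton's quaternions `ℍ = ℝ⁴`. -/
noncomputable def toH (q : ℍ[K]) : ℍ[ℝ] :=
  quat (toReal q.re) (toReal q.imI) (toReal q.imJ) (toReal q.imK)

/-- The twist map `(a, b, c, d) ↦ (a', b', d', c')`. -/
def twist (q : ℍ[K]) : ℍ[K] :=
  quat (conjK q.re) (conjK q.imI) (conjK q.imK) (conjK q.imJ)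

/-- The number `1/2` in `K`. -/
def half : K := ⟨1 / 2, 0⟩

/-- The icosians: the `ℤ[τ]`-linear combinations of
`(1,0,0,0)`, `(0,1,0,0)`, `(1,1,1,1)/2` and `(1-τ,τ,0,1)/2`. -/
def icosians : Submodule o ℍ[K] :=
  Submodule.span o {quat 1 0 0 0, quat 0 1 0 0,
    half • quat 1 1 1 1, half • quat (1 - tau) tau 0 1}

theorem normSq_mem {q : ℍ[K]} (hq : q ∈ icosians) : Quaternion.normSq q ∈ o := by
  rw [icosians, Submodule.mem_span_insert] at hq
  simp only [Submodule.mem_span_insert, Submodule.mem_span_singleton] at hq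
  obtain ⟨x, _, ⟨y, _, ⟨z, _, ⟨w, rfl⟩, rfl⟩, rfl⟩, rfl⟩ := hq
  have key : Quaternion.normSq (x • quat (1 : K) 0 0 0 + (y • quat (0 : K) 1 0 0 +
      (z • half • quat (1 : K) 1 1 1 + w • half • quat (1 - tau) tau 0 1))) =
      (x * x + y * y + z * z + w * w + x * z + y * z + (1 - tau) * (x * w)
        + tau * (y * w) + z * w : K) := by
    have h2 : half * 2 = 1 := by
      ext <;> simp [half, QuadraticAlgebra.re_one, QuadraticAlgebra.im_one,
        QuadraticAlgebra.re_ofNat, QuadraticAlgebra.im_ofNat]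
    have ht := tau_mul_tau
    have hs (s : o) (p : ℍ[K]) : s • p = quat (s * p.re) (s * p.imI) (s * p.imJ) (s * p.imK) := rfl
    have hk (s : K) (p : ℍ[K]) : s • p = quat (s * p.re) (s * p.imI) (s * p.imJ) (s * p.imK) := rfl
    have ha (p r : ℍ[K]) :
        p + r = quat (p.re + r.re) (p.imI + r.imI) (p.imJ + r.imJ) (p.imK + r.imK) := rfl
    have h_re (a b c d : K) : (quat a b c d).re = a := rfl
    have h_i (a b c d : K) : (quat a b c d).imI = b := rfl
    have h_j (a b c d : K) : (quat a b c d).imJ = c := rfl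
    have h_k (a b c d : K) : (quat a b c d).imK = d := rfl
    simp only [Quaternion.normSq_def', hs, hk, ha, h_re, h_i, h_j, h_k]
    linear_combination ((x : K) * z + (1 - tau) * (x * w) + y * z + tau * (y * w)) * h2 +
      (2 * half + 1) * ((z : K) * z + z * w + w * w) * h2 + 2 * half * half * w * w * ht
  rw [key]
  have ht := tau_mem
  have hx := x.2
  have hy := y.2
  have hz := z.2
  have hw := w.2
  have h1 := o.one_mem
  repeat first
    | assumption
    | apply o.add_mem
    | apply o.mul_mem
    | apply o.sub_mem

/-- The reduced norm `nr(q) = q q̄ = |q|²` of an icosian, which lies in `ℤ[τ]`. -/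
def nr (q : icosians) : o := ⟨Quaternion.normSq (q : ℍ[K]), normSq_mem q.2⟩

/-- An icosian `q` is primitive if `α q` with `α ∈ K` is an icosian only for `α ∈ ℤ[τ]`. -/
def IsPrimitive (q : icosians) : Prop :=
  ∀ α : K, α • (q : ℍ[K]) ∈ icosians → α ∈ o

/-- An icosian `q` is admissible if the Euclidean length `|q q̃|` is a natural number. -/
def IsAdmissible (q : icosians) : Prop :=
  ∃ n : ℕ, ‖toH (q * twist q)‖ = n

/-- `α ∈ ℤ[τ]` is the square root `√(ℓ / nr(q))`. -/
def IsExtensionFactor (q : icosians) (ℓ : ℕ) (α : o) : Prop :=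
  toReal α = √((ℓ : ℝ) / toReal (nr q))

/-- The extension `α q` of the icosian `q`. -/
def extension (q : icosians) (α : o) : icosians := α • q

/-- The root lattice `A₄`, realised in `ℝ⁴ = ℍ` as the `ℤ`-span of
`(1,0,0,0)`, `(-1,1,1,1)/2`, `(0,-1,0,0)` and `(0,1,τ-1,-τ)/2`. -/
noncomputable def L : AddSubgroup ℍ[ℝ] :=
  AddSubgroup.closure {quat 1 0 0 0, (1 / 2 : ℝ) • quat (-1) 1 1 1,
    quat 0 (-1) 0 0, (1 / 2 : ℝ) • quat 0 1 (φ - 1) (-φ)}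

end Icosian

namespace Icosian

attribute [local simp] QuadraticAlgebra.re_one QuadraticAlgebra.im_one
  QuadraticAlgebra.re_ofNat QuadraticAlgebra.im_ofNat

/-! ### Arithmetic of `ℤ[τ]` -/

/-! Write `𝕀` for the icosians, `N = |q q̃|` and `ℓ` for the natural lcm of `m = nr(q)` and its
conjugate `m'`. Up to the real embedding, `L` is the set of icosians fixed by the twist
(`L_eq_map`). Since `m m' = N²`, the inverse of `R_q` is `T x = N⁻¹ q̄ x s` with `s` the quaternion
conjugate of `q̃`, and `T` commutes with the twist. So `Σ(R_q)` is the index in `L` of `{x ∈ L | T x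
∈ L}` (`coincidenceIndex_eq`).

The index is first found on all of `𝕀`, where the condition reads `q̄ x s ∈ N 𝕀`. It localises at
prime powers `p ^ k` in the factorisation of `N`. There `𝕀` becomes the ring of `2 × 2` matrices
over `ℤ[τ]/p ^ k`, and primitivity lets the two factors be brought to the form `diag(1, nr)`. This
gives four independent scalar conditions on `x`. As `ℤ[τ]` is principal, `m ~ g α'²`, `m' ~ g α²`,
`N ~ g α α'` with `g` a gcd and `α`, `α'` coprime (`exists_gcd_conj_decomposition`). The four
indices then multiply to `(N α α')² = ℓ²` (`index_icosianColon_eq_sq`).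

Next this is transferred to `L`. Let `F` and `A` be the `+1` and `-1` parts of `𝕀` under the twist,
and `a`, `b` the indices of `{x | T x ∈ 𝕀}` in them. Splitting off `x + x̃` gives `a b = ℓ²`. Also
`√5 F ⊆ A` has index `5`, which gives `f b = 5 a` for some `f ∣ 25`. So `f ℓ² = 5 a²`, and
irrationality of `√5` forces `f = 5`, `a = ℓ` (`relIndex_fixedLattice`).

The same decomposition settles the lcm: it is associated to `g α² α'²`, hence to the integer `N α
α'`. The quotient `ℓ / m` is `α²` times a totally positive unit, which is a square
(`isSquare_of_totallyPositive`). -/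

instance fact_five_nonsquare : Fact (∀ r : ℚ, r ^ 2 ≠ 5 + 0 * r) := ⟨fun r hr => by
  have h5 : Irrational √5 := by simpa using Nat.Prime.irrational_sqrt (p := 5) (by norm_num)
  apply h5
  refine ⟨|r|, ?_⟩
  rw [eq_comm, Real.sqrt_eq_iff_mul_self_eq (by norm_num) (by positivity)]
  have : |r| * |r| = 5 := by rw [abs_mul_abs_self, ← sq, hr]; ring
  exact_mod_cast this.symm⟩

theorem norm_eq (x : K) : QuadraticAlgebra.norm x = x.re ^ 2 - 5 * x.im ^ 2 := by
  rw [QuadraticAlgebra.norm_def]; ring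

/-- The conjugation of `K`, as a ring homomorphism. -/
def conjKHom : K →+* K where
  toFun := conjK
  map_one' := by ext <;> simp [conjK]
  map_mul' x y := by ext <;> simp [conjK]; ring
  map_zero' := by ext <;> simp [conjK]
  map_add' x y := by ext <;> simp [conjK]; ring

@[simp] theorem conjKHom_apply (x : K) : conjKHom x = conjK x := rfl

@[simp] theorem conjK_conjK (x : K) : conjK (conjK x) = x := by ext <;> simp [conjK]

/-- The conjugation of `ℤ[τ]`, as a ring homomorphism. -/
def conjHom : o →+* o := (conjKHom.comp o.subtype).codRestrict o fun x => conjK_mem x.2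

theorem conjO_eq (x : o) : conjO x = conjHom x := rfl

@[simp] theorem coe_conjHom (x : o) : ((conjHom x : o) : K) = conjK x := rfl

@[simp] theorem conjHom_conjHom (x : o) : conjHom (conjHom x) = x := Subtype.ext (by simp)

theorem conjHom_ne_zero {x : o} (hx : x ≠ 0) : conjHom x ≠ 0 := fun h =>
  hx (by rw [← conjHom_conjHom x, h, map_zero])

/-- The element `√5` of `K`. -/
def sqrtFive : K := ⟨0, 1⟩

theorem sqrtFive_eq : sqrtFive = 2 * tau - 1 := by
  ext <;> simp [sqrtFive, tau]

theorem sqrtFive_mem : sqrtFive ∈ o := ⟨-1, 2, by rw [sqrtFive_eq]; push_cast; ring⟩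

theorem sqrtFive_mul_self : sqrtFive * sqrtFive = 5 := by
  ext <;> simp [sqrtFive]

theorem sqrtFive_ne_zero : sqrtFive ≠ 0 := fun h => by
  simpa [sqrtFive] using congrArg QuadraticAlgebra.im h

theorem exists_int_eq_norm (x : o) : ∃ k : ℤ, (k : ℚ) = QuadraticAlgebra.norm (x : K) := by
  obtain ⟨_, m, n, rfl⟩ := x
  refine ⟨m ^ 2 + m * n - n ^ 2, ?_⟩
  rw [norm_eq]
  simp [tau]
  ring

theorem mul_conjK (x : K) : x * conjK x = ((QuadraticAlgebra.norm x : ℚ) : K) := by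
  rw [norm_eq]
  ext <;> simp [conjK, sq] <;> ring

theorem exists_int_eq_mul_conj (x : o) : ∃ k : ℤ, (k : o) = x * conjHom x := by
  obtain ⟨k, hk⟩ := exists_int_eq_norm x
  refine ⟨k, Subtype.ext ?_⟩
  push_cast
  rw [coe_conjHom, mul_conjK, ← hk]
  simp

theorem norm_ne_zero {x : K} (hx : x ≠ 0) : QuadraticAlgebra.norm x ≠ 0 :=
  fun h => hx (QuadraticAlgebra.norm_eq_zero_iff_eq_zero.mp h)

/-- Rounding both coordinates with respect to `1, τ` leaves an error `s + t τ` with `|s|, |t| ≤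
1/2`, whose norm `s² + s t - t²` is small. This makes `ℤ[τ]` norm-Euclidean. -/
theorem exists_norm_sub_lt_one (x : K) : ∃ y : o, |QuadraticAlgebra.norm (x - (y : K))| < 1 := by
  set b : ℚ := 2 * x.im with hb
  set a : ℚ := x.re - x.im with ha
  refine ⟨⟨(round a : ℤ) + (round b : ℤ) * tau, _, _, rfl⟩, ?_⟩
  have h1 := abs_sub_round a
  have h2 := abs_sub_round b
  set s := a - round a with hs
  set t := b - round b with ht
  have : QuadraticAlgebra.norm (x - ((round a : ℤ) + (round b : ℤ) * tau : K))
      = s ^ 2 + s * t - t ^ 2 := by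
    rw [norm_eq]
    simp [tau, hs, ht, ha, hb]
    ring
  rw [this]
  rw [abs_le] at h1 h2
  rw [abs_lt]
  have h3 : s ^ 2 ≤ 1 / 4 := by nlinarith
  have h4 : t ^ 2 ≤ 1 / 4 := by nlinarith
  constructor <;> nlinarith [sq_nonneg (s - t), sq_nonneg (s + t)]

instance isPrincipalIdealRing_o : IsPrincipalIdealRing o := by
  classical
  constructor
  intro I
  by_cases hI : I = ⊥
  · exact ⟨0, by simp [hI]⟩
  choose f hf using exists_int_eq_norm
  obtain ⟨x0, hx0, hx0'⟩ := Submodule.exists_mem_ne_zero_of_ne_bot hI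
  obtain ⟨x, ⟨hxI, hx⟩, hmin⟩ := WellFounded.has_min
    (measure fun x : o => (f x).natAbs).wf {x : o | x ∈ I ∧ x ≠ 0} ⟨x0, hx0, hx0'⟩
  refine ⟨x, le_antisymm (fun y hy => ?_) ((Submodule.span_singleton_le_iff_mem _ _).2 hxI)⟩
  have hxK : (x : K) ≠ 0 := fun h => hx (Subtype.ext h)
  obtain ⟨z, hz⟩ := exists_norm_sub_lt_one ((y : K) / x)
  have hr : y - z * x = 0 := by
    by_contra hne
    refine hmin (y - z * x) ⟨I.sub_mem hy (I.mul_mem_left z hxI), hne⟩ ?_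
    change (f (y - z * x)).natAbs < (f x).natAbs
    have h1 : ((y - z * x : o) : K) = ((y : K) / x - z) * x := by
      push_cast; field_simp
    have h2 : |(f (y - z * x) : ℚ)| < |(f x : ℚ)| := by
      rw [hf, hf, h1, map_mul, abs_mul]
      exact mul_lt_of_lt_one_left (abs_pos.2 (norm_ne_zero hxK)) hz
    have h3 : |f (y - z * x)| < |f x| := by exact_mod_cast h2
    zify
    exact h3
  exact Submodule.mem_span_singleton.2 ⟨z, by rw [smul_eq_mul, ← sub_eq_zero.1 hr]⟩

/-- The real embedding of `K`, as a ring homomorphism. -/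
noncomputable def toRealHom : K →+* ℝ where
  toFun := toReal
  map_one' := by simp [toReal]
  map_mul' x y := by
    have : √5 * √5 = (5 : ℝ) := Real.mul_self_sqrt (by norm_num)
    simp [toReal]
    linear_combination (-(x.im : ℝ) * y.im) * this
  map_zero' := by simp [toReal]
  map_add' x y := by simp [toReal]; ring

@[simp] theorem toRealHom_apply (x : K) : toRealHom x = toReal x := rfl

theorem toReal_injective : Function.Injective toReal := toRealHom.injective

theorem toReal_add_conjK (x : K) : toReal x + toReal (conjK x) = 2 * x.re := by
  simp [toReal, conjK]; ring

theorem toReal_mul_conjK (x : K) :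
    toReal x * toReal (conjK x) = (QuadraticAlgebra.norm x : ℚ) := by
  rw [← toRealHom_apply, ← toRealHom_apply, ← map_mul, mul_conjK, map_ratCast]

/-- `τ`, as a unit of `ℤ[τ]`. -/
def tauUnit : oˣ where
  val := ⟨tau, tau_mem⟩
  inv := ⟨tau - 1, o.sub_mem tau_mem o.one_mem⟩
  val_inv := Subtype.ext (by push_cast; linear_combination tau_mul_tau)
  inv_val := Subtype.ext (by push_cast; linear_combination tau_mul_tau)

/-- Dividing by an even power of `τ` moves the unit into `[1, τ²)`. Its norm is then `1` by
positivity, so its trace is an integer below `τ² + τ⁻² = 3`, and a positive unit of norm `1` and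
trace at most `2` equals `1`. -/
theorem isSquare_of_totallyPositive (u : oˣ) (h1 : 0 < toReal (u : o))
    (h2 : 0 < toReal (conjK (u : o))) : ∃ v : oˣ, u = v ^ 2 := by
  let T : oˣ →* ℝˣ := Units.map (toRealHom.comp o.subtype : o →* ℝ)
  let T' : oˣ →* ℝˣ := Units.map (toRealHom.comp (conjKHom.comp o.subtype) : o →* ℝ)
  have hT (w : oˣ) : (T w : ℝ) = toReal (w : o) := rfl
  have hT' (w : oˣ) : (T' w : ℝ) = toReal (conjK (w : o)) := rfl
  have hs : √5 * √5 = (5 : ℝ) := Real.mul_self_sqrt (by norm_num)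
  have hs0 : 0 < √5 := by positivity
  have hs2 : 2 < √5 := by nlinarith
  have ht : toReal tau = (1 + √5) / 2 := by simp [toReal, tau]; ring
  have hc : (1 : ℝ) < (T tauUnit : ℝ) ^ 2 := by
    rw [hT]; change 1 < (toReal tau) ^ 2
    rw [ht]; nlinarith
  obtain ⟨n, hn1, hn2⟩ := exists_mem_Ico_zpow h1 hc
  set w : oˣ := u * (tauUnit ^ n)⁻¹ ^ 2 with hw
  have hpos : (0 : ℝ) < ((T tauUnit : ℝ) ^ 2) ^ n := zpow_pos (by linarith) _
  have hTw : toReal (w : o) * ((T tauUnit : ℝ) ^ 2) ^ n = toReal (u : o) := by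
    rw [← hT, ← hT, hw, map_mul, map_pow, map_inv, map_zpow]
    push_cast
    have h0 : (T tauUnit : ℝ) ≠ 0 := Units.ne_zero _
    rw [← zpow_natCast, ← zpow_natCast, ← zpow_mul, mul_comm _ n, zpow_mul, inv_zpow, mul_assoc,
      inv_mul_cancel₀ (zpow_ne_zero _ (zpow_ne_zero _ h0)), mul_one]
  have hw1 : 1 ≤ toReal (w : o) := by
    by_contra! h; nlinarith
  have hw2 : toReal (w : o) < (T tauUnit : ℝ) ^ 2 := by
    by_contra! h
    rw [zpow_add_one₀ (by linarith), ← hTw] at hn2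
    nlinarith
  have hw3 : 0 < toReal (conjK (w : o)) := by
    rw [← hT', hw, map_mul, map_pow]
    push_cast
    exact mul_pos h2 (sq_pos_of_ne_zero (Units.ne_zero _))
  obtain ⟨k, hk⟩ := exists_int_eq_norm (w : o)
  have hmul := toReal_mul_conjK (w : o)
  rw [← hk] at hmul
  have hk1 : k = 1 ∨ k = -1 := by
    obtain ⟨k', hk'⟩ := exists_int_eq_norm ((w⁻¹ : oˣ) : o)
    have : (k * k' : ℚ) = 1 := by
      rw [hk, hk', ← map_mul, ← Subring.coe_mul, Units.mul_inv]; simp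
    exact Int.eq_one_or_neg_one_of_mul_eq_one (by exact_mod_cast this)
  -- Norm `-1` is excluded because both real embeddings of `w` are positive.
  have hk2 : k = 1 := by
    rcases hk1 with h | h
    · exact h
    · rw [h] at hmul; push_cast at hmul; nlinarith
  rw [hk2] at hmul
  push_cast at hmul
  have hadd := toReal_add_conjK (w : o)
  obtain ⟨a, b, hab⟩ := (w : o).2
  have hre : (((w : o) : K).re : ℝ) * 2 = ((2 * a + b : ℤ) : ℝ) := by
    rw [hab]; simp [tau]; ring
  rw [hT] at hw2
  change _ < (toReal tau) ^ 2 at hw2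
  rw [ht] at hw2
  have hlt : ((2 * a + b : ℤ) : ℝ) < 3 := by
    rw [← hre, mul_comm, ← hadd]
    set x := toReal (w : o)
    set y := toReal (conjK (w : o))
    have hy : y ≤ 1 := by nlinarith
    by_contra! h
    nlinarith
  have hle : ((2 * a + b : ℤ) : ℝ) ≤ 2 := by
    have : 2 * a + b < 3 := by exact_mod_cast hlt
    exact_mod_cast (by omega : 2 * a + b ≤ 2)
  have hone : toReal (w : o) = 1 := by
    rw [← hre, mul_comm, ← hadd] at hle
    nlinarith [sq_nonneg (toReal (w : o) - 1)]
  have hwe : w = 1 := by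
    ext1; apply Subtype.ext; apply toReal_injective
    rw [hone]; simp [toReal]
  refine ⟨tauUnit ^ n, ?_⟩
  rw [hw, inv_pow, mul_inv_eq_one] at hwe
  exact hwe

/-! ### The least common multiple of `m` and its conjugate -/

/-- The ideal `(m, m')` is stable under conjugation, so its generator `g` is associated to its
conjugate. Cancelling `g²` from `m m' = N²` leaves a product of two coprime cofactors equal to a
square, so each cofactor is a square up to a unit, and conjugation exchanges the two. -/
theorem exists_gcd_conj_decomposition {m N : o} (hm : m ≠ 0) (hmN : m * conjHom m = N ^ 2) :
    ∃ g α : o, g ≠ 0 ∧ Associated m (g * conjHom α ^ 2) ∧ Associated (conjHom m) (g * α ^ 2) ∧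
      IsCoprime α (conjHom α) ∧ Associated N (g * (α * conjHom α)) := by
  obtain ⟨g, hg⟩ := IsPrincipalIdealRing.principal (Ideal.span {m, conjHom m})
  rw [Ideal.submodule_span_eq] at hg
  have hg1 : g ∣ m := by
    rw [← Ideal.mem_span_singleton, ← hg]; exact Ideal.subset_span (by simp)
  have hg2 : g ∣ conjHom m := by
    rw [← Ideal.mem_span_singleton, ← hg]; exact Ideal.subset_span (by simp)
  obtain ⟨x, y, hxy⟩ : ∃ x y, x * m + y * conjHom m = g := by
    rw [← Ideal.mem_span_pair, hg]; exact Ideal.mem_span_singleton_self g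
  have hg0 : g ≠ 0 := by rintro rfl; exact hm (zero_dvd_iff.1 hg1)
  have hgg : g ∣ conjHom g := by
    rw [← hxy, map_add, map_mul, map_mul, conjHom_conjHom, hxy]
    exact dvd_add (dvd_mul_of_dvd_right hg2 _) (dvd_mul_of_dvd_right hg1 _)
  have hass : Associated g (conjHom g) :=
    associated_of_dvd_dvd hgg (by simpa using map_dvd conjHom hgg)
  obtain ⟨a, ha⟩ := hg1
  obtain ⟨b, hb⟩ := hg2
  have hcop : IsCoprime b a := ⟨y, x, mul_left_cancel₀ hg0 (by
    linear_combination hxy - x * ha - y * hb)⟩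
  have hgN : g ∣ N := by
    rw [← IsIntegrallyClosed.pow_dvd_pow_iff (n := 2) two_ne_zero, ← hmN, hb]
    exact ⟨a * b, by rw [ha]; ring⟩
  obtain ⟨k, hk⟩ := hgN
  have hab : b * a = k ^ 2 := by
    refine mul_left_cancel₀ (pow_ne_zero 2 hg0) ?_
    linear_combination hmN - hb * m - g * b * ha + (N + g * k) * hk
  obtain ⟨α, hα⟩ := exists_associated_pow_of_mul_eq_pow' hcop hab
  have h2 : Associated (conjHom m) (g * α ^ 2) := by
    rw [hb]; exact hα.symm.mul_left g
  have h1 : Associated m (g * conjHom α ^ 2) := by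
    have := h2.map conjHom
    rw [conjHom_conjHom, map_mul, map_pow] at this
    exact this.trans (hass.symm.mul_right _)
  refine ⟨g, α, hg0, h1, h2, ?_, ?_⟩
  · have ha' : Associated a (conjHom α ^ 2) := by
      rw [ha] at h1
      exact h1.of_mul_left (Associated.refl g) hg0
    obtain ⟨u, hu⟩ := hα
    obtain ⟨v, hv⟩ := ha'
    have h3 : IsCoprime (α ^ 2) (conjHom α ^ 2) := by
      rw [← hv]
      exact ((isCoprime_mul_unit_right_right v.isUnit _ _).2 hcop).of_isCoprime_of_dvd_left
        ⟨u, hu.symm⟩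
    exact (IsCoprime.pow_iff (by norm_num) (by norm_num)).1 h3
  · have hsq : Associated (N ^ 2) ((g * (α * conjHom α)) ^ 2) := by
      have e : (g * (α * conjHom α)) ^ 2 = (g * conjHom α ^ 2) * (g * α ^ 2) := by ring
      rw [← hmN, e]
      exact h1.mul_mul h2
    exact associated_of_dvd_dvd
      ((IsIntegrallyClosed.pow_dvd_pow_iff two_ne_zero).1 hsq.dvd)
      ((IsIntegrallyClosed.pow_dvd_pow_iff two_ne_zero).1 hsq.symm.dvd)

theorem isLcm_of_associated {m m' g a b c : o} (hg : g ≠ 0) (h1 : Associated m (g * a))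
    (h2 : Associated m' (g * b)) (hab : IsCoprime a b) (hc : Associated c (g * a * b)) :
    IsLcm m m' c := by
  refine ⟨h1.dvd.trans ((dvd_mul_right _ _).trans hc.symm.dvd),
    h2.dvd.trans (Dvd.dvd.trans ⟨a, by ring⟩ hc.symm.dvd), fun d hd1 hd2 => ?_⟩
  obtain ⟨x, hx⟩ := h1.symm.dvd.trans hd1
  obtain ⟨y, hy⟩ := h2.symm.dvd.trans hd2
  have hxy : a * x = b * y := mul_left_cancel₀ hg (by linear_combination hy - hx)
  obtain ⟨z, hz⟩ := hab.symm.dvd_of_dvd_mul_left ⟨y, hxy⟩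
  exact hc.dvd.trans ⟨z, by rw [hx, hz]; ring⟩

theorem IsLcm.associated {R : Type*} [CommRing R] [IsDomain R] {a b c d : R} (hc : IsLcm a b c)
    (hd : IsLcm a b d) : Associated c d :=
  associated_of_dvd_dvd (hc.2.2 d hd.1 hd.2.1) (hd.2.2 c hc.1 hc.2.1)

theorem natAbs_eq_of_associated {a b : ℤ} (h : Associated (a : o) (b : o)) :
    a.natAbs = b.natAbs := by
  have key {a b : ℤ} (h : (a : o) ∣ (b : o)) : a ∣ b := by
    obtain ⟨⟨_, x, y, rfl⟩, hx⟩ := h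
    have hx := congrArg (Subtype.val) hx
    have him := congrArg QuadraticAlgebra.im hx
    have hre := congrArg QuadraticAlgebra.re hx
    simp [tau] at him hre
    refine ⟨x, ?_⟩
    have : (b : ℚ) = a * x := by
      rcases him with h | h <;> simp [h] at hre ⊢ <;> exact hre
    exact_mod_cast this
  exact Int.natAbs_eq_of_dvd_dvd (key h.dvd) (key h.symm.dvd)

/-! ### Colon ideals of `ℤ[τ]` and their indices -/

/-- The additive subgroup `{x | d x ∈ c ℤ[τ]}` of `ℤ[τ]`. -/
def colon (c d : o) : AddSubgroup o :=
  (Ideal.span {c}).toAddSubgroup.comap (AddMonoidHom.mulLeft d)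

theorem mem_colon {c d x : o} : x ∈ colon c d ↔ c ∣ d * x := by
  rw [colon, AddSubgroup.mem_comap]
  exact Ideal.mem_span_singleton

theorem colon_congr {c d c' d' : o} (hc : Associated c c') (hd : Associated d d') :
    colon c d = colon c' d' := by
  ext x
  rw [mem_colon, mem_colon]
  exact hc.dvd_iff_dvd_left.trans (hd.mul_right x).dvd_iff_dvd_right

theorem colon_mul_left {a c d : o} (ha : a ≠ 0) : colon (a * c) (a * d) = colon c d := by
  ext x
  rw [mem_colon, mem_colon, mul_assoc, mul_dvd_mul_iff_left ha]

theorem colon_of_isCoprime {c d : o} (h : IsCoprime c d) : colon c d = colon c 1 := by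
  ext x
  rw [mem_colon, mem_colon, one_mul]
  exact ⟨h.dvd_of_dvd_mul_left, fun h => dvd_mul_of_dvd_right h _⟩

theorem colon_of_dvd {c d : o} (h : c ∣ d) : colon c d = ⊤ :=
  top_le_iff.1 fun _ _ => mem_colon.2 (dvd_mul_of_dvd_left h _)

/-- `colon c 1` is the principal ideal `(c)`. In the `ℤ`-basis `1, τ` the ideal `(n)` is `nℤ × nℤ`.
-/
theorem index_colon_intCast_one (n : ℤ) : (colon n 1).index = n.natAbs ^ 2 := by
  let f : ℤ × ℤ →+ o :=
    { toFun := fun p => ⟨(p.1 : K) + (p.2 : K) * tau, _, _, rfl⟩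
      map_zero' := Subtype.ext (by simp)
      map_add' := fun p q => Subtype.ext (by push_cast; simp; ring) }
  have hf : Function.Surjective f := by
    rintro ⟨_, x, y, rfl⟩; exact ⟨(x, y), rfl⟩
  rw [← AddSubgroup.index_comap_of_surjective _ hf]
  have : (colon n 1).comap f =
      (AddSubgroup.zmultiples n).prod (AddSubgroup.zmultiples n) := by
    ext ⟨x, y⟩
    rw [AddSubgroup.mem_comap, mem_colon, one_mul, AddSubgroup.mem_prod, Int.mem_zmultiples_iff,
      Int.mem_zmultiples_iff]
    constructor
    · rintro ⟨⟨_, a, b, rfl⟩, h⟩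
      have h := congrArg Subtype.val h
      have him := congrArg QuadraticAlgebra.im h
      have hre := congrArg QuadraticAlgebra.re h
      simp [tau, f] at him hre
      constructor
      · refine ⟨a, ?_⟩
        have : (x : ℚ) = n * a := by linear_combination hre - him
        exact_mod_cast this
      · refine ⟨b, ?_⟩
        have : (y : ℚ) = n * b := by linear_combination 2 * him
        exact_mod_cast this
    · rintro ⟨⟨a, rfl⟩, ⟨b, rfl⟩⟩
      exact ⟨f (a, b), Subtype.ext (by simp [f]; ring)⟩
  rw [this, AddSubgroup.index_prod, Int.index_zmultiples, sq]

/-- Multiplication by `c` identifies `ℤ[τ]/(d)` with `(c)/(c d)`. -/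
theorem index_colon_mul {c d : o} (hc : c ≠ 0) :
    (colon (c * d) 1).index = (colon c 1).index * (colon d 1).index := by
  let f : o →+ o := AddMonoidHom.mulLeft c
  have hf : Function.Injective f := mul_right_injective₀ hc
  have h1 : colon c 1 = f.range := by
    ext x
    simp only [mem_colon, one_mul, AddMonoidHom.mem_range, f, dvd_def,
      AddMonoidHom.coe_mulLeft, eq_comm]
  have h2 : colon (c * d) 1 = (colon d 1).map f := by
    ext x
    simp only [mem_colon, one_mul, AddSubgroup.mem_map, f, dvd_def, AddMonoidHom.coe_mulLeft]
    constructor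
    · rintro ⟨y, rfl⟩; exact ⟨d * y, ⟨y, rfl⟩, by ring⟩
    · rintro ⟨_, ⟨y, rfl⟩, rfl⟩; exact ⟨y, by ring⟩
  rw [h2, AddSubgroup.index_map_of_injective _ hf, h1, mul_comm]

/-! ### The icosians as an order -/

theorem two_mul_half : 2 * half = 1 := by
  ext <;> simp [half]

@[simp] theorem re_quat {R : Type*} [CommRing R] (a b c d : R) : (quat a b c d).re = a := rfl

@[simp] theorem imI_quat {R : Type*} [CommRing R] (a b c d : R) : (quat a b c d).imI = b := rfl

@[simp] theorem imJ_quat {R : Type*} [CommRing R] (a b c d : R) : (quat a b c d).imJ = c := rfl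

@[simp] theorem imK_quat {R : Type*} [CommRing R] (a b c d : R) : (quat a b c d).imK = d := rfl

theorem coe_o_smul (c : o) (p : ℍ[K]) : c • p = (c : K) • p := rfl

/-- The quaternion with given coordinates with respect to the basis of the icosian ring. -/
def icos (x y z w : K) : ℍ[K] :=
  ⟨x + half * z + half * ((1 - tau) * w), y + half * z + half * (tau * w), half * z,
    half * z + half * w⟩

@[simp] theorem re_icos (x y z w : K) :
    (icos x y z w).re = x + half * z + half * ((1 - tau) * w) := rfl

@[simp] theorem imI_icos (x y z w : K) :
    (icos x y z w).imI = y + half * z + half * (tau * w) := rfl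

@[simp] theorem imJ_icos (x y z w : K) : (icos x y z w).imJ = half * z := rfl

@[simp] theorem imK_icos (x y z w : K) : (icos x y z w).imK = half * z + half * w := rfl

theorem mem_icosians_iff {q : ℍ[K]} :
    q ∈ icosians ↔ ∃ x ∈ o, ∃ y ∈ o, ∃ z ∈ o, ∃ w ∈ o, q = icos x y z w := by
  have key (x y z w : o) : (icos x y z w : ℍ[K]) = x • quat (1 : K) 0 0 0 +
      (y • quat (0 : K) 1 0 0 + (z • half • quat (1 : K) 1 1 1 +
        w • half • quat (1 - tau) tau 0 1)) := by
    ext1 <;> simp [coe_o_smul] <;> ring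
  rw [icosians]
  simp only [Submodule.mem_span_insert, Submodule.mem_span_singleton]
  constructor
  · rintro ⟨x, _, ⟨y, _, ⟨z, _, ⟨w, rfl⟩, rfl⟩, rfl⟩, rfl⟩
    exact ⟨x, x.2, y, y.2, z, z.2, w, w.2, (key x y z w).symm⟩
  · rintro ⟨x, hx, y, hy, z, hz, w, hw, rfl⟩
    exact ⟨⟨x, hx⟩, _, ⟨⟨y, hy⟩, _, ⟨⟨z, hz⟩, _, ⟨⟨w, hw⟩, rfl⟩, rfl⟩, rfl⟩,
      key ⟨x, hx⟩ ⟨y, hy⟩ ⟨z, hz⟩ ⟨w, hw⟩⟩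

/-- All structure constants lie in `ℤ[τ]`, which is why the icosians are closed under
multiplication. -/
theorem icos_mul (x y z w x' y' z' w' : K) : icos x y z w * icos x' y' z' w' =
    icos
      (x * x' - y * y' + (tau - 1) * (y * z') - tau * (z * y') - z * z' - z * w' - tau * (w * y')
        - w * w')
      (x * y' + y * x' + (1 - tau) * (y * z') + (1 - tau) * (y * w') + tau * (z * y') + z * w'
        - w * z')
      (x * z' + z * x' - y * z' - y * w' + z * y' + z * z' + w * y' + (1 - tau) * (w * z'))
      (x * w' + w * x' + 2 * (y * z') + y * w' - 2 * (z * y') + (1 - tau) * (z * w') - w * y'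
        + tau * (w * z') + (1 - tau) * (w * w')) := by
  have h2 := two_mul_half
  have ht := tau_mul_tau
  ext1 <;> simp <;> grind

theorem icosians_mul_mem {p q : ℍ[K]} (hp : p ∈ icosians) (hq : q ∈ icosians) :
    p * q ∈ icosians := by
  obtain ⟨x, hx, y, hy, z, hz, w, hw, rfl⟩ := mem_icosians_iff.1 hp
  obtain ⟨x', hx', y', hy', z', hz', w', hw', rfl⟩ := mem_icosians_iff.1 hq
  rw [icos_mul, mem_icosians_iff]
  have ht := tau_mem
  have h1 := o.one_mem
  have h2 : (2 : K) ∈ o := natCast_mem o 2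
  refine ⟨_, ?_, _, ?_, _, ?_, _, ?_, rfl⟩ <;>
  repeat first
    | assumption
    | apply o.add_mem
    | apply o.sub_mem
    | apply o.mul_mem

theorem one_mem_icosians : (1 : ℍ[K]) ∈ icosians :=
  mem_icosians_iff.2 ⟨1, o.one_mem, 0, o.zero_mem, 0, o.zero_mem, 0, o.zero_mem, by
    ext1 <;> simp⟩

theorem smul_mem_icosians {c : K} (hc : c ∈ o) {q : ℍ[K]} (hq : q ∈ icosians) :
    c • q ∈ icosians := icosians.smul_mem ⟨c, hc⟩ hq

theorem star_mem_icosians {q : ℍ[K]} (hq : q ∈ icosians) : star q ∈ icosians := by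
  obtain ⟨x, hx, y, hy, z, hz, w, hw, rfl⟩ := mem_icosians_iff.1 hq
  refine mem_icosians_iff.2 ⟨x + z + (1 - tau) * w, ?_, -y, o.neg_mem hy, -z, o.neg_mem hz, -w,
    o.neg_mem hw, ?_⟩
  · exact o.add_mem (o.add_mem hx hz) (o.mul_mem (o.sub_mem o.one_mem tau_mem) hw)
  · have h2 := two_mul_half
    ext1 <;> simp
    · linear_combination (z + (1 - tau) * w) * h2
    all_goals ring

/-- The icosians, as an order in `ℍ(K)`. -/
def icosianOrder : Subalgebra o ℍ[K] :=
  icosians.toSubalgebra one_mem_icosians fun _ _ => icosians_mul_mem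

/-! ### Reduced trace, reduced norm and conjugation on the icosians -/

/-- The conjugate of an icosian. -/
def conj (x : icosianOrder) : icosianOrder := ⟨star (x : ℍ[K]), star_mem_icosians x.2⟩

/-- The reduced norm of an icosian. -/
def rnorm (x : icosianOrder) : o := nr x

theorem two_mul_re_mem {q : ℍ[K]} (hq : q ∈ icosians) : 2 * q.re ∈ o := by
  obtain ⟨x, hx, y, hy, z, hz, w, hw, rfl⟩ := mem_icosians_iff.1 hq
  have h2 := two_mul_half
  have : 2 * (icos x y z w).re = x + x + z + (1 - tau) * w := by
    rw [re_icos]; linear_combination (z + (1 - tau) * w) * h2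
  rw [this]
  exact o.add_mem (o.add_mem (o.add_mem hx hx) hz) (o.mul_mem (o.sub_mem o.one_mem tau_mem) hw)

/-- The reduced trace of an icosian. -/
def rtrace : icosianOrder →ₗ[o] o where
  toFun x := ⟨2 * (x : ℍ[K]).re, two_mul_re_mem x.2⟩
  map_add' x y := Subtype.ext (by simp [mul_add])
  map_smul' c x := Subtype.ext (by
    change 2 * ((c : K) * (x : ℍ[K]).re) = c * (2 * (x : ℍ[K]).re); ring)

@[simp] theorem coe_conj (x : icosianOrder) : (conj x : ℍ[K]) = star (x : ℍ[K]) := rfl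

theorem coe_rtrace (x : icosianOrder) : (rtrace x : K) = 2 * (x : ℍ[K]).re := rfl

theorem coe_rnorm (x : icosianOrder) : (rnorm x : K) = Quaternion.normSq (x : ℍ[K]) := rfl

theorem coe_smul (c : o) (x : icosianOrder) :
    ((c • x : icosianOrder) : ℍ[K]) = (c : K) • (x : ℍ[K]) := rfl

theorem rtrace_mul_comm (x y : icosianOrder) : rtrace (x * y) = rtrace (y * x) := by
  ext1; simp [coe_rtrace]; ring

theorem rtrace_conj (x : icosianOrder) : rtrace (conj x) = rtrace x := by
  ext1; simp [coe_rtrace]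

theorem conj_mul (x y : icosianOrder) : conj (x * y) = conj y * conj x := by
  ext1; simp

theorem rnorm_mul (x y : icosianOrder) : rnorm (x * y) = rnorm x * rnorm y := by
  ext1; simp [coe_rnorm]

theorem rnorm_conj (x : icosianOrder) : rnorm (conj x) = rnorm x := by
  ext1; simp [coe_rnorm]

theorem mul_conj (x : icosianOrder) : x * conj x = rnorm x • 1 := by
  ext1
  rw [coe_smul, coe_rnorm]
  ext1 <;> simp [Quaternion.self_mul_star]

theorem conj_eq (x : icosianOrder) : conj x = rtrace x • 1 - x := by
  ext1
  rw [Subalgebra.coe_sub, coe_smul, coe_rtrace, coe_conj]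
  ext1 <;> simp
  ring

/-- Replace `g x` by its trace minus its conjugate `x̄ ḡ`, and use `ḡ g = nr(g)`. When `N ∣ nr(g)`
this says that `g` behaves modulo `N` like a rank one matrix. -/
theorem mul_mul_self (g x : icosianOrder) : g * x * g = rtrace (g * x) • g - rnorm g • conj x := by
  ext1
  rw [Subalgebra.coe_sub, coe_smul, coe_smul, coe_rtrace, coe_conj, coe_rnorm]
  ext1 <;> simp [Quaternion.normSq_def'] <;> ring

/-- The icosian with given coordinates. -/
def ofCoords (x y z w : o) : icosianOrder :=
  ⟨icos x y z w, mem_icosians_iff.2 ⟨x, x.2, y, y.2, z, z.2, w, w.2, rfl⟩⟩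

@[simp] theorem coe_ofCoords (x y z w : o) : (ofCoords x y z w : ℍ[K]) = icos x y z w := rfl

/-- The element `τ` of `ℤ[τ]`. -/
def tauO : o := ⟨tau, tau_mem⟩

@[simp] theorem coe_tauO : (tauO : K) = tau := rfl

/-- The standard basis of the icosian ring. -/
def basisVec : Fin 4 → icosianOrder :=
  ![ofCoords 1 0 0 0, ofCoords 0 1 0 0, ofCoords 0 0 1 0, ofCoords 0 0 0 1]

/-- The dual of the standard basis with respect to the reduced trace. -/
def dualVec : Fin 4 → icosianOrder :=
  ![ofCoords (-1) 1 tauO (1 - 2 * tauO), ofCoords 1 (-2) (1 - tauO) (-1 + 2 * tauO),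
    ofCoords tauO (1 - tauO) (-2) 2, ofCoords (1 - 2 * tauO) (-1 + 2 * tauO) 2 (-4)]

/-- The dual basis again consists of icosians: the trace form on the icosian ring is unimodular over
`ℤ[τ]`. This is what allows splitting at every prime. -/
theorem sum_rtrace_smul (x : icosianOrder) :
    ∑ i, rtrace (x * dualVec i) • basisVec i = x := by
  have h2 := two_mul_half
  have ht := tau_mul_tau
  have c2 : ((2 : o) : K) = 2 := rfl
  have c4 : ((4 : o) : K) = 4 := rfl
  simp only [Fin.sum_univ_four, basisVec, dualVec]
  ext1
  simp only [Subalgebra.coe_add, coe_smul, coe_rtrace, Subalgebra.coe_mul]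
  ext1 <;> simp [c2, c4] <;> grind

/-- The Casimir identity, familiar from matrix units as `∑ Eᵢⱼ x Eⱼᵢ = tr(x)`. -/
theorem sum_mul_mul_dual (x : icosianOrder) :
    ∑ i, basisVec i * x * dualVec i = rtrace x • 1 := by
  have h2 := two_mul_half
  have ht := tau_mul_tau
  have c2 : ((2 : o) : K) = 2 := rfl
  have c4 : ((4 : o) : K) = 4 := rfl
  simp only [Fin.sum_univ_four, basisVec, dualVec]
  ext1
  simp only [Subalgebra.coe_add, coe_smul, coe_rtrace, Subalgebra.coe_mul]
  ext1 <;> simp [c2, c4] <;> grind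

/-! ### Splitting the icosians modulo `N` -/

theorem exists_eq_smul_of_dvd_rtrace {c : o} {x : icosianOrder}
    (h : ∀ d, c ∣ rtrace (x * d)) : ∃ y : icosianOrder, x = c • y := by
  choose k hk using fun i => h (dualVec i)
  refine ⟨∑ i, k i • basisVec i, ?_⟩
  conv_lhs => rw [← sum_rtrace_smul x]
  simp only [hk, mul_smul, Finset.smul_sum]

/-- The polarised Cayley–Hamilton identity. For a splitting it reduces to `g h + h g = 1` modulo
`N`. -/
theorem mul_add_mul (g h : icosianOrder) :
    g * h + h * g = rtrace g • h + rtrace h • g + (rtrace (g * h) - rtrace g * rtrace h) • 1 := by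
  ext1
  simp only [Subalgebra.coe_add, coe_smul, AddSubgroupClass.coe_sub, Subring.coe_mul, coe_rtrace,
    Subalgebra.coe_mul]
  ext1 <;> simp <;> ring

/-- The reduced trace modulo `N`. -/
def traceMod (N : o) : icosianOrder →+ o ⧸ Ideal.span {N} :=
  (Ideal.Quotient.mk (Ideal.span {N}) : o →+ _).comp rtrace.toAddMonoidHom

theorem traceMod_apply (N : o) (x : icosianOrder) :
    traceMod N x = Ideal.Quotient.mk (Ideal.span {N}) (rtrace x) := rfl

variable {N : o}

theorem traceMod_smul (c : o) (x : icosianOrder) :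
    traceMod N (c • x) = Ideal.Quotient.mk _ c * traceMod N x := by
  simp [traceMod_apply]

theorem traceMod_mul_comm (x y : icosianOrder) : traceMod N (x * y) = traceMod N (y * x) := by
  rw [traceMod_apply, rtrace_mul_comm, traceMod_apply]

theorem mk_eq_zero_iff {c : o} : Ideal.Quotient.mk (Ideal.span {N}) c = 0 ↔ N ∣ c := by
  rw [Ideal.Quotient.eq_zero_iff_mem, Ideal.mem_span_singleton]

theorem traceMod_smul_of_dvd {c : o} (hc : N ∣ c) (x : icosianOrder) :
    traceMod N (c • x) = 0 := by
  rw [traceMod_smul, mk_eq_zero_iff.2 hc, zero_mul]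

/-- If `N` divides the reduced norm of `g`, then `g` has rank one modulo `N`. -/
theorem traceMod_mul_mul_mul_mul {g : icosianOrder} (hg : N ∣ rnorm g) (a x b : icosianOrder) :
    traceMod N (a * (g * x * g) * b) = traceMod N (g * x) * traceMod N (a * g * b) := by
  rw [mul_mul_self, mul_sub, sub_mul, map_sub, mul_smul_comm, mul_smul_comm, smul_mul_assoc,
    smul_mul_assoc, traceMod_smul, traceMod_smul_of_dvd hg, sub_zero, traceMod_apply N (g * x)]

/-- Icosians `g`, `h` which modulo `N` behave like the matrix units `e₁₂` and `e₂₁`. -/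
structure IsSplitting (N : o) (g h : icosianOrder) : Prop where
  trace_left : N ∣ rtrace g
  trace_right : N ∣ rtrace h
  norm_left : N ∣ rnorm g
  norm_right : N ∣ rnorm h
  trace_mul : N ∣ rtrace (g * h) - 1

namespace IsSplitting

variable {g h : icosianOrder} (H : IsSplitting N g h)
include H

theorem traceMod_left : traceMod N g = 0 := mk_eq_zero_iff.2 H.trace_left

theorem traceMod_right : traceMod N h = 0 := mk_eq_zero_iff.2 H.trace_right

theorem traceMod_mul : traceMod N (g * h) = 1 := by
  rw [← sub_eq_zero, ← map_one (Ideal.Quotient.mk _), traceMod_apply, ← map_sub]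
  exact mk_eq_zero_iff.2 H.trace_mul

theorem traceMod_insert (x y : icosianOrder) :
    traceMod N (x * y) = traceMod N (x * (g * h) * y) + traceMod N (x * (h * g) * y) := by
  have h1 := H.traceMod_mul
  rw [traceMod_apply] at h1
  rw [← map_add, ← add_mul, ← mul_add, mul_add_mul]
  simp only [mul_add, add_mul, mul_smul_comm, smul_mul_assoc, map_add]
  rw [traceMod_smul_of_dvd H.trace_left, traceMod_smul_of_dvd H.trace_right, traceMod_smul,
    map_sub, map_mul (Ideal.Quotient.mk _), mk_eq_zero_iff.2 H.trace_left, h1]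
  simp

theorem one_insert (y : icosianOrder) :
    traceMod N y = traceMod N (y * (g * h)) + traceMod N (y * (h * g)) := by
  simpa using H.traceMod_insert y 1

/-- The ring homomorphism from the icosians to `2 × 2` matrices modulo `N` given by a splitting. -/
def toMatrix : icosianOrder →+* Matrix (Fin 2) (Fin 2) (o ⧸ Ideal.span {N}) where
  toFun x := !![traceMod N (x * (g * h)), traceMod N (x * h);
    traceMod N (x * g), traceMod N (x * (h * g))]
  map_zero' := by ext i j; fin_cases i <;> fin_cases j <;> simp
  map_add' x y := by ext i j; fin_cases i <;> fin_cases j <;> simp [add_mul]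
  map_one' := by
    rw [one_mul, one_mul, one_mul, one_mul, traceMod_mul_comm h g, H.traceMod_mul,
      H.traceMod_left, H.traceMod_right, Matrix.one_fin_two]
  map_mul' x y := by
    -- Each entry of the product is obtained by inserting `1 = g h + h g` between `x` and `y`, and
    -- then factoring every trace that contains `g z g` or `h z h` by the rank one property.
    have c := @traceMod_mul_comm N
    have G := @traceMod_mul_mul_mul_mul N g H.norm_left
    have G' := @traceMod_mul_mul_mul_mul N h H.norm_right
    have e := H.traceMod_mul
    rw [Matrix.mul_fin_two]
    congr 1
    ext i j
    fin_cases i <;> fin_cases j <;> simp only [Fin.zero_eta, Fin.mk_one,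
      Matrix.cons_val', Matrix.cons_val_zero, Matrix.cons_val_one, Matrix.cons_val_fin_one]
    · have h1 := G' (x * g) (y * g) 1
      have h2 := G (x * h) y h
      have h3 := G' 1 g x
      have h4 := c x (h * (g * h))
      have h5 := c h (y * g)
      rw [mul_assoc x y, H.traceMod_insert]
      simp only [one_mul, mul_one, mul_assoc] at h1 h2 h3 h4 h5 ⊢
      rw [h1, h2, h4, h3, h5, c h g, e, c h x, c g y]; ring
    · have h1 := G' (x * g) y 1
      have h2 := G' 1 x (g * y)
      have h3 := c (x * h * g * y) h
      have h4 := c (h * g) y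
      rw [mul_assoc x y, H.traceMod_insert]
      simp only [one_mul, mul_one, mul_assoc] at h1 h2 h3 h4 ⊢
      rw [h1, h3, h2, h4, c h y, c h x]; ring
    · have h1 := G 1 x (h * y)
      have h2 := G (x * h) y 1
      have h3 := c (x * g * h * y) g
      have h4 := c (g * h) y
      rw [mul_assoc x y, H.traceMod_insert]
      simp only [one_mul, mul_one, mul_assoc] at h1 h2 h3 h4 ⊢
      rw [h3, h1, h2, h4, c g y, c g x]; ring
    · have h1 := G' (x * g) y g
      have h2 := G x h 1
      have h3 := G (x * h) (y * h) 1
      have h4 := c g (y * h)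
      rw [mul_assoc x y, H.traceMod_insert]
      simp only [mul_one, mul_assoc] at h1 h2 h3 h4 ⊢
      rw [h1, h2, h3, h4, e, c h y]; ring

theorem toMatrix_apply (x : icosianOrder) : H.toMatrix x =
    !![traceMod N (x * (g * h)), traceMod N (x * h);
      traceMod N (x * g), traceMod N (x * (h * g))] := rfl

theorem trace_toMatrix (x : icosianOrder) : (H.toMatrix x).trace = traceMod N x := by
  rw [H.one_insert x, toMatrix_apply, Matrix.trace_fin_two]
  rfl

theorem toMatrix_smul (c : o) (x : icosianOrder) :
    H.toMatrix (c • x) = Ideal.Quotient.mk (Ideal.span {N}) c • H.toMatrix x := by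
  simp only [toMatrix_apply, smul_mul_assoc, traceMod_smul]
  ext i j
  fin_cases i <;> fin_cases j <;> rfl

/-- If the matrix of `x` vanishes then so do all traces `tr(x d)` modulo `N`, and unimodularity of
the trace form makes `x` divisible by `N`. -/
theorem toMatrix_eq_zero_iff {x : icosianOrder} : H.toMatrix x = 0 ↔ ∃ y, x = N • y := by
  constructor
  · refine fun hx => exists_eq_smul_of_dvd_rtrace fun d => ?_
    rw [← mk_eq_zero_iff, ← traceMod_apply, ← H.trace_toMatrix, map_mul, hx]
    simp
  · rintro ⟨y, rfl⟩
    ext i j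
    rw [toMatrix_smul, Matrix.smul_apply, mk_eq_zero_iff.2 dvd_rfl]
    exact zero_mul _

/-- Conjugation of icosians corresponds to the adjugate, so the upper left entry of `x x̄ = nr(x)`
is the determinant. -/
theorem det_toMatrix (x : icosianOrder) :
    (H.toMatrix x).det = Ideal.Quotient.mk (Ideal.span {N}) (rnorm x) := by
  have c := @traceMod_mul_comm N
  have hconj (y z : icosianOrder) : traceMod N (conj y * z) = traceMod N (conj z * y) := by
    rw [traceMod_apply, traceMod_apply, ← rtrace_conj (conj y * z), conj_mul]
    congr 3
    ext1; simp
  have hg (y : icosianOrder) : traceMod N (conj g * y) = -traceMod N (g * y) := by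
    rw [conj_eq, sub_mul, smul_mul_assoc, map_sub, traceMod_smul_of_dvd H.trace_left, zero_sub]
  have hh (y : icosianOrder) : traceMod N (conj h * y) = -traceMod N (h * y) := by
    rw [conj_eq, sub_mul, smul_mul_assoc, map_sub, traceMod_smul_of_dvd H.trace_right, zero_sub]
  have h1 : traceMod N (conj x * (g * h)) = traceMod N (x * (h * g)) := by
    rw [hconj, conj_mul, mul_assoc, hh, c h, mul_assoc, hg, neg_neg, c g, mul_assoc]
  have h2 : traceMod N (conj x * g) = -traceMod N (x * g) := by
    rw [hconj, hg, c]
  have h3 := congrArg (fun M => M 0 0) (map_mul H.toMatrix x (conj x))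
  simp only [mul_conj, toMatrix_smul, map_one] at h3
  rw [toMatrix_apply, toMatrix_apply, h1, h2, Matrix.mul_fin_two] at h3
  rw [toMatrix_apply, Matrix.det_fin_two_of]
  simpa [sub_eq_add_neg] using h3.symm

theorem surjective_toMatrix : Function.Surjective H.toMatrix := by
  have c := @traceMod_mul_comm N
  have G := @traceMod_mul_mul_mul_mul N g H.norm_left
  have G' := @traceMod_mul_mul_mul_mul N h H.norm_right
  have e := H.traceMod_mul
  have hg : H.toMatrix g = !![0, 1; 0, 0] := by
    have h1 := G 1 1 h
    have h2 := G 1 1 1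
    have h3 := G 1 h 1
    simp only [one_mul, mul_one, mul_assoc] at h1 h2 h3
    rw [toMatrix_apply, h1, h2, h3, e, H.traceMod_left]
    simp
  have hh : H.toMatrix h = !![0, 0; 1, 0] := by
    have h1 := G' 1 g 1
    have h2 := G' 1 1 1
    have h3 := G' 1 1 g
    simp only [one_mul, mul_one, mul_assoc] at h1 h2 h3
    rw [toMatrix_apply, h1, h2, h3, c h g, e, H.traceMod_right]
    simp
  intro M
  obtain ⟨p, hp⟩ := Ideal.Quotient.mk_surjective (M 0 0)
  obtain ⟨q, hq⟩ := Ideal.Quotient.mk_surjective (M 0 1)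
  obtain ⟨r, hr⟩ := Ideal.Quotient.mk_surjective (M 1 0)
  obtain ⟨s, hs⟩ := Ideal.Quotient.mk_surjective (M 1 1)
  refine ⟨p • (g * h) + q • g + r • h + s • (h * g), ?_⟩
  simp only [map_add, toMatrix_smul, map_mul, hg, hh, hp, hq, hr, hs]
  ext i j
  fin_cases i <;> fin_cases j <;> simp

end IsSplitting

theorem conj_mul_self (x : icosianOrder) : conj x * x = rnorm x • 1 := by
  ext1
  rw [coe_smul, coe_rnorm]
  ext1 <;> simp [Quaternion.star_mul_self]

/-- Unimodularity gives a multiple `e` of `r` with trace `1` and norm `0` modulo `N = p ^ k`, so `e`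
and `ē` are complementary idempotents there. The matrix units are sought in `e 𝕀 ē` and `ē 𝕀 e`. -/
theorem exists_isSplitting {p : o} (hp : Prime p) {k : ℕ} (hk : k ≠ 0) {r : icosianOrder}
    (hr : ¬ ∃ y, r = p • y) (hnr : p ^ k ∣ rnorm r) :
    ∃ g h, IsSplitting (p ^ k) g h := by
  have hpk : p ∣ p ^ k := dvd_pow_self p hk
  obtain ⟨d, hd⟩ : ∃ d, ¬ p ∣ rtrace (r * d) := by
    by_contra! h
    exact hr (exists_eq_smul_of_dvd_rtrace h)
  obtain ⟨v, c, hc⟩ := (hp.coprime_iff_not_dvd.2 hd).pow_left (m := k)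
  set N := p ^ k with hN
  set e := r * (c • d) with he
  have hne : N ∣ rnorm e := by
    rw [he, rnorm_mul]; exact dvd_mul_of_dvd_left hnr _
  have hte : rtrace e = 1 - v * N := by
    rw [he, mul_smul_comm, map_smul, smul_eq_mul, ← hc]; ring
  have hρ : traceMod N e = 1 := by
    rw [traceMod_apply, hte, map_sub, map_mul, mk_eq_zero_iff.2 dvd_rfl]; simp
  have hρ' : traceMod N (conj e) = 1 := by
    rw [traceMod_apply, rtrace_conj]; exact hρ
  -- By the Casimir identity these traces sum to `tr(e) tr(ē)`, which is `1` modulo `p`, so one of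
  -- them is prime to `p`.
  obtain ⟨i, hi⟩ : ∃ i, ¬ p ∣ rtrace (e * basisVec i * conj e * dualVec i) := by
    by_contra! h
    have h1 : p ∣ ∑ i, rtrace (e * basisVec i * conj e * dualVec i) :=
      Finset.dvd_sum fun i _ => h i
    rw [← map_sum] at h1
    simp only [mul_assoc] at h1
    rw [← Finset.mul_sum] at h1
    simp only [← mul_assoc] at h1
    rw [sum_mul_mul_dual, mul_smul_comm, map_smul, mul_one, rtrace_conj, smul_eq_mul] at h1
    have h2 := hp.dvd_or_dvd h1
    rw [or_self, hte] at h2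
    refine hp.not_isUnit (isUnit_of_dvd_one ?_)
    simpa using dvd_add h2 (dvd_mul_of_dvd_right hpk v)
  set g := e * basisVec i * conj e with hg
  set h := conj e * dualVec i * e with hh
  have hgh : traceMod N (g * h) = traceMod N (e * basisVec i * conj e * dualVec i) := by
    have h1 := traceMod_mul_mul_mul_mul hne 1 1 (basisVec i * conj e * conj e * dualVec i)
    have h2 := traceMod_mul_mul_mul_mul (N := N) (g := conj e) (by rwa [rnorm_conj])
      (e * basisVec i) 1 (dualVec i)
    have h3 := traceMod_mul_comm (N := N) (e * basisVec i * conj e * conj e * dualVec i) e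
    rw [hg, hh]
    simp only [one_mul, mul_one, mul_assoc, hρ, hρ'] at h1 h2 h3 ⊢
    rw [h3, h1, h2]
  have hgh' : ¬ p ∣ rtrace (g * h) := by
    intro hdiv
    apply hi
    rw [traceMod_apply, traceMod_apply, ← sub_eq_zero, ← map_sub, mk_eq_zero_iff] at hgh
    simpa using dvd_sub hdiv (hpk.trans hgh)
  -- `b` inverts `tr(g h)` modulo `p ^ k`; rescaling `h` by it normalises the trace to `1`.
  obtain ⟨w, b, hb⟩ := (hp.coprime_iff_not_dvd.2 hgh').pow_left (m := k)
  refine ⟨g, b • h, ?_, ?_, ?_, ?_, ?_⟩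
  · rw [hg, mul_assoc, rtrace_mul_comm, mul_assoc, conj_mul_self, mul_smul_comm, map_smul]
    exact dvd_mul_of_dvd_left hne _
  · rw [map_smul, hh, mul_assoc, rtrace_mul_comm, mul_assoc, mul_conj, mul_smul_comm, map_smul]
    exact dvd_mul_of_dvd_right (dvd_mul_of_dvd_left hne _) _
  · rw [hg, rnorm_mul, rnorm_mul, mul_assoc]; exact dvd_mul_of_dvd_left hne _
  · have : b • h = (b • (conj e * dualVec i)) * e := by rw [smul_mul_assoc]
    rw [this, rnorm_mul]; exact dvd_mul_of_dvd_right hne _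
  · rw [mul_smul_comm, map_smul, smul_eq_mul]
    exact ⟨-w, by linear_combination hb⟩

/-! ### The index of `{x | r x s ∈ N 𝕀}`, prime by prime -/

/-- Smith normal form of a `2 × 2` matrix with a unit entry. -/
theorem exists_mul_mul_eq_diagonal {S : Type*} [CommRing S] (A : Matrix (Fin 2) (Fin 2) S)
    (hA : ∃ i j, IsUnit (A i j)) : ∃ P Q : (Matrix (Fin 2) (Fin 2) S)ˣ,
      A = P * !![1, 0; 0, A.det] * Q := by
  have key (B : Matrix (Fin 2) (Fin 2) S) (hB : IsUnit (B 0 0)) :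
      ∃ P Q : (Matrix (Fin 2) (Fin 2) S)ˣ, B = P * !![1, 0; 0, B.det] * Q := by
    obtain ⟨a, b, c, d, rfl⟩ : ∃ a b c d, B = !![a, b; c, d] := ⟨_, _, _, _, B.eta_fin_two⟩
    obtain ⟨u, hu⟩ : IsUnit a := hB
    have h1 : a * ↑u⁻¹ = 1 := by rw [← hu, Units.mul_inv]
    -- Both outer factors have determinant `1`, so the second diagonal entry is exactly the
    -- determinant.
    refine ⟨⟨!![a, 0; c, ↑u⁻¹], !![↑u⁻¹, 0; -c, a], ?_, ?_⟩,
      ⟨!![1, ↑u⁻¹ * b; 0, 1], !![1, -(↑u⁻¹ * b); 0, 1], ?_, ?_⟩, ?_⟩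
    · rw [Matrix.mul_fin_two, Matrix.one_fin_two]; congr 2 <;> grind
    · rw [Matrix.mul_fin_two, Matrix.one_fin_two]; congr 2 <;> grind
    · rw [Matrix.mul_fin_two, Matrix.one_fin_two]; congr 2 <;> grind
    · rw [Matrix.mul_fin_two, Matrix.one_fin_two]; congr 2 <;> grind
    · rw [Matrix.det_fin_two_of, Matrix.mul_fin_two, Matrix.mul_fin_two]; congr 2 <;> grind
  -- A signed swap of determinant `1`, used to move the unit entry to the upper left corner without
  -- changing the determinant.
  let w : (Matrix (Fin 2) (Fin 2) S)ˣ := ⟨!![0, 1; -1, 0], !![0, -1; 1, 0],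
    by simp [Matrix.one_fin_two], by simp [Matrix.one_fin_two]⟩
  have hw : (w : Matrix (Fin 2) (Fin 2) S).det = 1 := by simp [w]
  have red (U V : (Matrix (Fin 2) (Fin 2) S)ˣ) (hU : (U : Matrix (Fin 2) (Fin 2) S).det = 1)
      (hV : (V : Matrix (Fin 2) (Fin 2) S).det = 1)
      (h : IsUnit (((U : Matrix (Fin 2) (Fin 2) S) * A * V) 0 0)) :
      ∃ P Q : (Matrix (Fin 2) (Fin 2) S)ˣ, A = P * !![1, 0; 0, A.det] * Q := by
    obtain ⟨P, Q, hPQ⟩ := key _ h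
    rw [Matrix.det_mul, Matrix.det_mul, hU, hV, one_mul, mul_one] at hPQ
    refine ⟨U⁻¹ * P, Q * V⁻¹, ?_⟩
    calc A = ↑U⁻¹ * (U * A * V) * ↑V⁻¹ := by
          simp only [mul_assoc, Units.mul_inv, mul_one, Units.inv_mul_cancel_left]
      _ = _ := by rw [hPQ]; simp only [mul_assoc, Units.val_mul]
  obtain ⟨i, j, hij⟩ := hA
  have h1 : ((1 : (Matrix (Fin 2) (Fin 2) S)ˣ) : Matrix (Fin 2) (Fin 2) S).det = 1 := by simp
  fin_cases i <;> fin_cases j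
  · exact red 1 1 h1 h1 (by simpa using hij)
  · exact red 1 w h1 hw (by rw [A.eta_fin_two]; simpa [w] using hij)
  · exact red w 1 hw h1 (by rw [A.eta_fin_two]; simpa [w] using hij)
  · exact red w w hw hw (by rw [A.eta_fin_two]; simpa [w] using hij)

/-- The additive subgroup `{x | r x s ∈ N 𝕀}` of the icosians. -/
def icosianColon (N : o) (r s : icosianOrder) : AddSubgroup icosianOrder :=
  (AddMonoidHom.range (DistribSMul.toAddMonoidHom icosianOrder N)).comap
    ((AddMonoidHom.mulLeft r).comp (AddMonoidHom.mulRight s))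

theorem mem_icosianColon {N : o} {r s x : icosianOrder} :
    x ∈ icosianColon N r s ↔ ∃ y, r * x * s = N • y := by
  rw [icosianColon, AddSubgroup.mem_comap, AddMonoidHom.mem_range]
  simp only [eq_comm, mul_assoc]
  rfl

theorem index_colon_eq_ker (N d : o) : (colon N d).index =
    (AddMonoidHom.mulLeft (Ideal.Quotient.mk (Ideal.span {N}) d)).ker.index := by
  have hf : Function.Surjective (Ideal.Quotient.mk (Ideal.span {N}) : o →+ o ⧸ Ideal.span {N}) :=
    Ideal.Quotient.mk_surjective
  rw [← AddSubgroup.index_comap_of_surjective _ hf]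
  congr 1
  ext x
  rw [mem_colon, ← mk_eq_zero_iff, AddSubgroup.mem_comap, AddMonoidHom.mem_ker, map_mul]
  rfl

/-- In `ℤ[τ]/p ^ k` every non-unit is a multiple of `p`. A matrix `p C` lifts to `p x`, which
differs from `r` by an element of `p ^ k 𝕀`, so `r` would be divisible by `p`. -/
theorem IsSplitting.exists_isUnit_entry {p : o} (hp : Prime p) {k : ℕ} (hk : k ≠ 0)
    {g h : icosianOrder} (H : IsSplitting (p ^ k) g h) {r : icosianOrder}
    (hr : ¬ ∃ y, r = p • y) : ∃ i j, IsUnit (H.toMatrix r i j) := by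
  by_contra! hu
  apply hr
  have key (i j) : ∃ c : o, H.toMatrix r i j = Ideal.Quotient.mk (Ideal.span {p ^ k}) (p * c) := by
    obtain ⟨c, hc⟩ := Ideal.Quotient.mk_surjective (H.toMatrix r i j)
    by_cases hpc : p ∣ c
    · obtain ⟨c', rfl⟩ := hpc
      exact ⟨c', hc.symm⟩
    · exfalso
      apply hu i j
      obtain ⟨a, b, hab⟩ := (hp.coprime_iff_not_dvd.2 hpc).pow_left (m := k)
      rw [← hc]
      refine IsUnit.of_mul_eq_one (Ideal.Quotient.mk _ b) ?_
      rw [← map_mul, ← sub_eq_zero, ← map_one (Ideal.Quotient.mk _), ← map_sub, mk_eq_zero_iff]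
      exact ⟨-a, by linear_combination hab⟩
  choose c hc using key
  obtain ⟨x, hx⟩ := H.surjective_toMatrix (Matrix.of fun i j => Ideal.Quotient.mk _ (c i j))
  have h0 : H.toMatrix (r - p • x) = 0 := by
    rw [map_sub, H.toMatrix_smul, hx]
    ext i j
    rw [Matrix.sub_apply, hc, map_mul]
    exact sub_self _
  obtain ⟨y, hy⟩ := H.toMatrix_eq_zero_iff.1 h0
  obtain ⟨l, rfl⟩ := Nat.exists_eq_succ_of_ne_zero hk
  refine ⟨x + p ^ l • y, ?_⟩
  rw [smul_add, smul_smul, ← pow_succ', ← hy]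
  abel

/-- With `A` and `B` in Smith form the equation becomes `diag(1, a) Y diag(1, b) = 0`, where `Y`
runs over all matrices. It splits into one condition per entry, with multipliers `1, b, a, a b`. -/
theorem index_of_mem_iff_mul_mul_eq_zero {S G : Type*} [CommRing S] [AddCommGroup G]
    (Ψ : G →+ Matrix (Fin 2) (Fin 2) S) (hΨ : Function.Surjective Ψ)
    {A B : Matrix (Fin 2) (Fin 2) S} (hA : ∃ i j, IsUnit (A i j)) (hB : ∃ i j, IsUnit (B i j))
    {H : AddSubgroup G} (hH : ∀ x, x ∈ H ↔ A * Ψ x * B = 0) :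
    H.index = (AddMonoidHom.mulLeft (1 : S)).ker.index * ((AddMonoidHom.mulLeft B.det).ker.index *
      ((AddMonoidHom.mulLeft A.det).ker.index *
        (AddMonoidHom.mulLeft (A.det * B.det)).ker.index)) := by
  obtain ⟨P, Q, hPQ⟩ := exists_mul_mul_eq_diagonal _ hA
  obtain ⟨P', Q', hPQ'⟩ := exists_mul_mul_eq_diagonal _ hB
  generalize A.det = a at *
  generalize B.det = b at *
  let f : G →+ S × S × S × S :=
    AddMonoidHom.mk' (fun x =>
      let Y := (Q : Matrix (Fin 2) (Fin 2) S) * Ψ x * P'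
      (Y 0 0, Y 0 1, Y 1 0, Y 1 1))
      fun x y => by simp [mul_add, add_mul]
  have hf : Function.Surjective f := by
    rintro ⟨y1, y2, y3, y4⟩
    obtain ⟨x, hx⟩ := hΨ (((Q⁻¹ : (Matrix (Fin 2) (Fin 2) S)ˣ) : Matrix (Fin 2) (Fin 2) S) *
      !![y1, y2; y3, y4] * ((P'⁻¹ : (Matrix (Fin 2) (Fin 2) S)ˣ) : Matrix (Fin 2) (Fin 2) S))
    refine ⟨x, ?_⟩
    have : (Q : Matrix (Fin 2) (Fin 2) S) * Ψ x * P' = !![y1, y2; y3, y4] := by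
      rw [hx]; simp only [mul_assoc, Units.inv_mul, mul_one, Units.mul_inv_cancel_left]
    simp [f, this]
  rw [← AddSubgroup.index_prod, ← AddSubgroup.index_prod, ← AddSubgroup.index_prod,
    ← AddSubgroup.index_comap_of_surjective _ hf]
  congr 1
  ext x
  have e : A * Ψ x * B = P * (!![1, 0; 0, a] * (Q * Ψ x * P') * !![1, 0; 0, b]) * Q' := by
    rw [hPQ, hPQ']; simp only [mul_assoc]
  rw [hH, e, Units.mul_left_eq_zero, Units.mul_right_eq_zero]
  change _ ↔ (1 * (Q * Ψ x * P' : Matrix (Fin 2) (Fin 2) S) 0 0 = 0 ∧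
    b * (Q * Ψ x * P' : Matrix (Fin 2) (Fin 2) S) 0 1 = 0 ∧
    a * (Q * Ψ x * P' : Matrix (Fin 2) (Fin 2) S) 1 0 = 0 ∧
    a * b * (Q * Ψ x * P' : Matrix (Fin 2) (Fin 2) S) 1 1 = 0)
  generalize (Q * Ψ x * P' : Matrix (Fin 2) (Fin 2) S) = Y
  rw [Y.eta_fin_two, Matrix.mul_fin_two, Matrix.mul_fin_two, ← Matrix.ext_iff]
  simp [Fin.forall_fin_two, and_assoc, mul_comm, mul_left_comm, mul_assoc]

theorem index_icosianColon_prime_pow {p : o} (hp : Prime p) {k : ℕ} (hk : k ≠ 0)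
    {r s : icosianOrder} (hr : ¬ ∃ y, r = p • y) (hs : ¬ ∃ y, s = p • y)
    (hrs : p ^ k ∣ rnorm r ∨ p ^ k ∣ rnorm s) :
    (icosianColon (p ^ k) r s).index = (colon (p ^ k) 1).index * ((colon (p ^ k) (rnorm s)).index *
      ((colon (p ^ k) (rnorm r)).index * (colon (p ^ k) (rnorm r * rnorm s)).index)) := by
  obtain ⟨g, h, H⟩ : ∃ g h, IsSplitting (p ^ k) g h :=
    hrs.elim (exists_isSplitting hp hk hr) (exists_isSplitting hp hk hs)
  simp only [index_colon_eq_ker, map_mul, map_one]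
  rw [← H.det_toMatrix, ← H.det_toMatrix]
  refine index_of_mem_iff_mul_mul_eq_zero H.toMatrix.toAddMonoidHom H.surjective_toMatrix
    (H.exists_isUnit_entry hp hk hr) (H.exists_isUnit_entry hp hk hs) fun x => ?_
  rw [mem_icosianColon, ← H.toMatrix_eq_zero_iff, map_mul, map_mul]
  rfl

theorem index_icosianColon_of_isUnit {N : o} (h : IsUnit N) (r s : icosianOrder) :
    (icosianColon N r s).index = (colon N 1).index * ((colon N (rnorm s)).index *
      ((colon N (rnorm r)).index * (colon N (rnorm r * rnorm s)).index)) := by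
  have hc (d : o) : colon N d = ⊤ := colon_of_dvd h.dvd
  have hi : icosianColon N r s = ⊤ := top_le_iff.1 fun x _ => by
    obtain ⟨u, rfl⟩ := h
    exact mem_icosianColon.2 ⟨(↑u⁻¹ : o) • (r * x * s), by simp [smul_smul]⟩
  simp [hc, hi]

/-- The index form of the Chinese remainder theorem, used to pass from prime powers to `N`. -/
theorem index_inf_of_sup_eq_top {A : Type*} [AddCommGroup A] {H H' : AddSubgroup A}
    (h : H ⊔ H' = ⊤) : (H ⊓ H').index = H.index * H'.index := by
  rw [← AddSubgroup.relIndex_top_right (H := H ⊓ H'), ← AddSubgroup.relIndex_inf_mul_relIndex,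
    inf_top_eq, AddSubgroup.relIndex_top_right, ← AddSubgroup.relIndex_sup_left,
    h, AddSubgroup.relIndex_top_right]

theorem index_colon_mul_of_isCoprime {x y : o} (h : IsCoprime x y) (d : o) :
    (colon (x * y) d).index = (colon x d).index * (colon y d).index := by
  rw [← index_inf_of_sup_eq_top]
  · congr 1
    ext z
    rw [AddSubgroup.mem_inf, mem_colon, mem_colon, mem_colon]
    exact ⟨fun hz => ⟨(dvd_mul_right _ _).trans hz, (dvd_mul_left _ _).trans hz⟩,
      fun hz => h.mul_dvd hz.1 hz.2⟩
  · obtain ⟨a, b, hab⟩ := h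
    refine top_le_iff.1 fun z _ => AddSubgroup.mem_sup.2 ⟨x * (a * z), ?_, y * (b * z), ?_, ?_⟩
    · exact mem_colon.2 ⟨d * (a * z), by ring⟩
    · exact mem_colon.2 ⟨d * (b * z), by ring⟩
    · linear_combination z * hab

theorem index_icosianColon_mul_of_isCoprime {x y : o} (h : IsCoprime x y) (r s : icosianOrder) :
    (icosianColon (x * y) r s).index = (icosianColon x r s).index * (icosianColon y r s).index := by
  obtain ⟨a, b, hab⟩ := h
  have hz (z : icosianOrder) : x • a • z + y • b • z = z := by
    rw [smul_smul, smul_smul, ← add_smul, mul_comm x, mul_comm y, hab, one_smul]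
  rw [← index_inf_of_sup_eq_top]
  · congr 1
    ext z
    rw [AddSubgroup.mem_inf, mem_icosianColon, mem_icosianColon, mem_icosianColon]
    constructor
    · rintro ⟨v, hv⟩
      exact ⟨⟨y • v, by rw [hv, mul_smul]⟩, ⟨x • v, by rw [hv, mul_comm, mul_smul]⟩⟩
    · rintro ⟨⟨v, hv⟩, ⟨w, hw⟩⟩
      refine ⟨a • w + b • v, ?_⟩
      rw [← hz (r * z * s)]
      nth_rw 1 [hw]
      rw [hv, smul_add, smul_smul, smul_smul, smul_smul, smul_smul, smul_smul, smul_smul]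
      congr 2 <;> ring
  · refine top_le_iff.1 fun z _ => AddSubgroup.mem_sup.2 ⟨x • a • z, ?_, y • b • z, ?_, hz z⟩
    · exact mem_icosianColon.2 ⟨r * (a • z) * s, by rw [mul_smul_comm, smul_mul_assoc]⟩
    · exact mem_icosianColon.2 ⟨r * (b • z) * s, by rw [mul_smul_comm, smul_mul_assoc]⟩

/-- Both sides are multiplicative over coprime factors of `N`. The hypothesis `hrs` supplies, at
each prime power, an element from which the splitting is built. -/
theorem index_icosianColon {N : o} (hN : N ≠ 0) {r s : icosianOrder}
    (hr : ∀ p : o, Prime p → ¬ ∃ y, r = p • y) (hs : ∀ p : o, Prime p → ¬ ∃ y, s = p • y)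
    (hrs : ∀ (p : o) (k : ℕ), Prime p → p ^ k ∣ N → p ^ k ∣ rnorm r ∨ p ^ k ∣ rnorm s) :
    (icosianColon N r s).index = (colon N 1).index * ((colon N (rnorm s)).index *
      ((colon N (rnorm r)).index * (colon N (rnorm r * rnorm s)).index)) := by
  induction N using UniqueFactorizationMonoid.induction_on_coprime with
  | h0 => exact absurd rfl hN
  | @h1 N h => exact index_icosianColon_of_isUnit h r s
  | @hpr p k hp =>
    rcases eq_or_ne k 0 with rfl | hk
    · exact index_icosianColon_of_isUnit (pow_zero p ▸ isUnit_one) r s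
    · exact index_icosianColon_prime_pow hp hk (hr p hp) (hs p hp) (hrs p k hp dvd_rfl)
  | @hcp x y hxy hx hy =>
    have hcop : IsCoprime x y := hxy.isCoprime
    rw [index_icosianColon_mul_of_isCoprime hcop, hx (left_ne_zero_of_mul hN)
      fun p k hp h => hrs p k hp (h.trans (dvd_mul_right _ _)), hy (right_ne_zero_of_mul hN)
      fun p k hp h => hrs p k hp (h.trans (dvd_mul_left _ _))]
    simp only [index_colon_mul_of_isCoprime hcop]
    ring

theorem IsLcm.ne_zero {R : Type*} [CommRing R] [IsDomain R] {a b c : R} (h : IsLcm a b c)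
    (ha : a ≠ 0) (hb : b ≠ 0) : c ≠ 0 := by
  rintro rfl
  exact mul_ne_zero ha hb (zero_dvd_iff.1 (h.2.2 _ (dvd_mul_right _ _) (dvd_mul_left _ _)))

/-- The index of `{x | r x s ∈ N 𝕀}`, for `r` and `s` primitive of conjugate norms. -/
theorem index_icosianColon_eq_sq {r s : icosianOrder} {N : ℤ} {ℓ : ℕ} (hN : N ≠ 0)
    (hr0 : rnorm r ≠ 0) (hs : rnorm s = conjHom (rnorm r))
    (hrN : rnorm r * conjHom (rnorm r) = N ^ 2)
    (hr : ∀ p : o, Prime p → ¬ ∃ y, r = p • y) (hs' : ∀ p : o, Prime p → ¬ ∃ y, s = p • y)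
    (hℓ : IsLcm (rnorm r) (conjHom (rnorm r)) (ℓ : o)) :
    (icosianColon N r s).index = ℓ ^ 2 := by
  obtain ⟨g, α, hg, h1, h2, hcop, h3⟩ := exists_gcd_conj_decomposition hr0 hrN
  set α' := conjHom α with hα'
  obtain ⟨k, hk⟩ := exists_int_eq_mul_conj α
  rw [← hα'] at hk
  have hN0 : (N : o) ≠ 0 := by exact_mod_cast hN
  have hgα : g * (α * α') ≠ 0 := fun h => hN0 (by
    rw [h] at h3; exact (associated_zero_iff_eq_zero _).1 h3)
  have hα0 : α ≠ 0 := left_ne_zero_of_mul (right_ne_zero_of_mul hgα)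
  have hα0' : α' ≠ 0 := right_ne_zero_of_mul (right_ne_zero_of_mul hgα)
  have hlcm : Associated (ℓ : o) ((N * k : ℤ) : o) := by
    refine hℓ.associated (isLcm_of_associated hg h1 h2 hcop.symm.pow ?_)
    have e : g * α' ^ 2 * α ^ 2 = g * (α * α') * (α * α') := by ring
    push_cast
    rw [hk, e]
    exact h3.mul_right _
  have hℓ' : ℓ = (N * k).natAbs := by
    have := natAbs_eq_of_associated (a := (ℓ : ℤ)) (b := N * k)
      (by push_cast at hlcm ⊢; exact hlcm)
    simpa using this
  -- Cancel `g α'` from `N ~ g α α'` and `nr(r) ~ g α'²`; the remaining `α'` is coprime to `α`.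
  have c1 : colon (N : o) (rnorm r) = colon α 1 := by
    have e1 : g * (α * α') = (g * α') * α := by ring
    have e2 : g * α' ^ 2 = (g * α') * α' := by ring
    rw [colon_congr h3 h1, e1, e2, colon_mul_left (mul_ne_zero hg hα0'), colon_of_isCoprime hcop]
  have c2 : colon (N : o) (rnorm s) = colon α' 1 := by
    have e1 : g * (α * α') = (g * α) * α' := by ring
    have e2 : g * α ^ 2 = (g * α) * α := by ring
    rw [hs, colon_congr h3 h2, e1, e2, colon_mul_left (mul_ne_zero hg hα0),
      colon_of_isCoprime hcop.symm]
  -- The fourth condition is void, since the product of the norms is `N²`.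
  have c3 : colon (N : o) (rnorm r * rnorm s) = ⊤ := by
    rw [hs, hrN]; exact colon_of_dvd (dvd_pow_self _ two_ne_zero)
  rw [index_icosianColon hN0 hr hs', c1, c2, c3, AddSubgroup.index_top, mul_one,
    mul_comm (colon α' 1).index, ← index_colon_mul hα0, ← hk, index_colon_intCast_one,
    index_colon_intCast_one, hℓ', Int.natAbs_mul, mul_pow]
  intro p k hp hpk
  -- A prime divides at most one of `α`, `α'`, so its power in `N ~ g α α'` already divides `g α` or
  -- `g α'`, hence one of the two norms.
  by_cases hpα : p ∣ α
  · right
    have hpα' : ¬ p ∣ α' := fun h => hp.not_isUnit (hcop.isUnit_of_dvd' hpα h)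
    have hd : p ^ k ∣ α' * (g * α) := by
      have e1 : α' * (g * α) = g * (α * α') := by ring
      rw [e1]; exact hpk.trans h3.dvd
    rw [hs]
    exact ((((hp.coprime_iff_not_dvd.2 hpα').pow_left).dvd_of_dvd_mul_left hd).trans
      ⟨α, by ring⟩).trans h2.symm.dvd
  · left
    have hd : p ^ k ∣ α * (g * α') := by
      have e1 : α * (g * α') = g * (α * α') := by ring
      rw [e1]; exact hpk.trans h3.dvd
    exact ((((hp.coprime_iff_not_dvd.2 hpα).pow_left).dvd_of_dvd_mul_left hd).trans
      ⟨α', by ring⟩).trans h1.symm.dvd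

/-! ### The natural lcm and the square root of its quotient by the norm -/

/-- Existence and uniqueness of a natural least common multiple. -/
theorem existsUnique_natCast_isLcm {m : o} {N : ℤ} (hm : m ≠ 0) (hN : m * conjHom m = N ^ 2) :
    ∃! ℓ : ℕ, IsLcm m (conjHom m) (ℓ : o) := by
  obtain ⟨g, α, hg, h1, h2, hcop, h3⟩ := exists_gcd_conj_decomposition hm hN
  set α' := conjHom α with hα'
  obtain ⟨k, hk⟩ := exists_int_eq_mul_conj α
  rw [← hα'] at hk
  have hlcm : IsLcm m (conjHom m) ((N * k : ℤ) : o) := by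
    refine isLcm_of_associated hg h1 h2 hcop.symm.pow ?_
    have e : g * α' ^ 2 * α ^ 2 = g * (α * α') * (α * α') := by ring
    push_cast
    rw [hk, e]
    exact h3.mul_right _
  refine ⟨(N * k).natAbs, ?_, fun ℓ hℓ => ?_⟩
  · change IsLcm _ _ _
    rcases Int.natAbs_eq (N * k) with h | h <;> rw [h] at hlcm <;> simpa [IsLcm] using hlcm
  · have := natAbs_eq_of_associated (a := (ℓ : ℤ)) (b := N * k)
      (by simpa using hℓ.associated hlcm)
    simpa using this

/-- The quotient of the lcm of `m` and its conjugate by `m` is a square. -/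
theorem exists_mul_sq_eq_lcm {m : o} {N : ℤ} {ℓ : ℕ} (hm : m ≠ 0)
    (hpos : 0 < toReal m) (hpos' : 0 < toReal (conjK m)) (hN : m * conjHom m = N ^ 2)
    (hℓ : IsLcm m (conjHom m) (ℓ : o)) : ∃ β : o, m * β ^ 2 = ℓ ∧ 0 ≤ toReal β := by
  obtain ⟨g, α, hg, h1, h2, hcop, h3⟩ := exists_gcd_conj_decomposition hm hN
  obtain ⟨u, hu⟩ : Associated (m * α ^ 2) (ℓ : o) :=
    (h1.mul_right _).trans
      ((isLcm_of_associated hg h1 h2 hcop.symm.pow (Associated.refl _)).associated hℓ)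
  have hℓ0 : ℓ ≠ 0 := by
    rintro rfl
    exact hℓ.ne_zero hm (conjHom_ne_zero hm) Nat.cast_zero
  have hℓ1 : (0 : ℝ) < ℓ := by exact_mod_cast Nat.pos_of_ne_zero hℓ0
  have e1 : toReal m * toReal α ^ 2 * toReal (u : o) = ℓ := by
    have := congrArg (toRealHom.comp o.subtype) hu
    simp only [map_mul, map_pow, map_natCast] at this
    exact this
  have e2 : toReal (conjK m) * toReal (conjK α) ^ 2 * toReal (conjK (u : o)) = ℓ := by
    have := congrArg (toRealHom.comp (conjKHom.comp o.subtype)) hu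
    simp only [map_mul, map_pow, map_natCast] at this
    exact this
  -- In both real embeddings `u` is a positive number divided by a positive one, so it is totally
  -- positive and its square root can be absorbed into `α`.
  obtain ⟨v, hv⟩ := isSquare_of_totallyPositive u
    (pos_of_mul_pos_right (e1 ▸ hℓ1) (by positivity))
    (pos_of_mul_pos_right (e2 ▸ hℓ1) (by positivity))
  have key : m * (α * v) ^ 2 = ℓ := by rw [← hu, hv]; push_cast; ring
  rcases le_total 0 (toReal ((α * v : o) : K)) with h | h
  · exact ⟨α * v, key, h⟩
  · refine ⟨-(α * v), by rw [neg_sq, key], ?_⟩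
    have : toReal ((-(α * v) : o) : K) = -toReal ((α * v : o) : K) :=
      map_neg (toRealHom.comp o.subtype) _
    rw [this]; linarith

/-! ### The twist map and its eigenlattices -/

@[simp] theorem re_twist (q : ℍ[K]) : (twist q).re = conjK q.re := rfl

@[simp] theorem imI_twist (q : ℍ[K]) : (twist q).imI = conjK q.imI := rfl

@[simp] theorem imJ_twist (q : ℍ[K]) : (twist q).imJ = conjK q.imK := rfl

@[simp] theorem imK_twist (q : ℍ[K]) : (twist q).imK = conjK q.imJ := rfl

theorem conjK_add (x y : K) : conjK (x + y) = conjK x + conjK y := map_add conjKHom x y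

theorem conjK_sub (x y : K) : conjK (x - y) = conjK x - conjK y := map_sub conjKHom x y

theorem conjK_mul (x y : K) : conjK (x * y) = conjK x * conjK y := map_mul conjKHom x y

theorem conjK_neg (x : K) : conjK (-x) = -conjK x := map_neg conjKHom x

theorem conjK_half : conjK half = half := by ext <;> simp [conjK, half]

theorem conjK_tau : conjK tau = 1 - tau := by ext <;> simp [conjK, tau]; norm_num

theorem conjK_sqrtFive : conjK sqrtFive = -sqrtFive := by ext <;> simp [conjK, sqrtFive]

theorem conjK_one : conjK 1 = 1 := map_one conjKHom

theorem conjK_intCast (n : ℤ) : conjK n = n := map_intCast conjKHom n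

theorem twist_add (p q : ℍ[K]) : twist (p + q) = twist p + twist q := by
  ext1 <;> simp [conjK_add]

theorem twist_neg (p : ℍ[K]) : twist (-p) = -twist p := by
  ext1 <;> simp [conjK_neg]

theorem twist_smul (c : K) (p : ℍ[K]) : twist (c • p) = conjK c • twist p := by
  ext1 <;> simp [conjK_mul]

theorem twist_mul (p q : ℍ[K]) : twist (p * q) = twist q * twist p := by
  ext1 <;> simp [conjK_mul, conjK_add, conjK_sub] <;> ring

theorem twist_star (p : ℍ[K]) : twist (star p) = star (twist p) := by
  ext1 <;> simp [conjK_neg]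

@[simp] theorem twist_twist (p : ℍ[K]) : twist (twist p) = p := by
  ext1 <;> simp

theorem normSq_twist (p : ℍ[K]) :
    Quaternion.normSq (twist p) = conjK (Quaternion.normSq p) := by
  simp [Quaternion.normSq_def', conjK_mul, conjK_add, pow_two]; ring

theorem twist_icos (x y z w : K) : twist (icos x y z w) =
    icos (conjK x) (conjK y) (conjK z + conjK w) (-conjK w) := by
  ext1 <;> simp [conjK_mul, conjK_add, conjK_sub, conjK_half, conjK_tau, conjK_one] <;> ring

theorem twist_mem {q : ℍ[K]} (hq : q ∈ icosians) : twist q ∈ icosians := by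
  obtain ⟨x, hx, y, hy, z, hz, w, hw, rfl⟩ := mem_icosians_iff.1 hq
  rw [twist_icos]
  exact mem_icosians_iff.2 ⟨_, conjK_mem hx, _, conjK_mem hy, _,
    o.add_mem (conjK_mem hz) (conjK_mem hw), _, o.neg_mem (conjK_mem hw), rfl⟩

theorem icos_inj {x y z w x' y' z' w' : K} :
    icos x y z w = icos x' y' z' w' ↔ x = x' ∧ y = y' ∧ z = z' ∧ w = w' := by
  refine ⟨fun h => ?_, by rintro ⟨rfl, rfl, rfl, rfl⟩; rfl⟩
  have h2 := two_mul_half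
  have h0 := congrArg QuaternionAlgebra.re h
  have hi := congrArg QuaternionAlgebra.imI h
  have hj := congrArg QuaternionAlgebra.imJ h
  have hk := congrArg QuaternionAlgebra.imK h
  simp only [re_icos, imI_icos, imJ_icos, imK_icos] at h0 hi hj hk
  have hz : z = z' := by linear_combination 2 * hj - (z - z') * h2
  have hw : w = w' := by linear_combination 2 * hk - 2 * hj - (w - w') * h2
  subst hz hw
  exact ⟨by linear_combination h0, by linear_combination hi, rfl, rfl⟩

/-- The twist-invariant icosians. -/
def fixedLattice : AddSubgroup ℍ[K] where
  carrier := {q | q ∈ icosians ∧ twist q = q}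
  zero_mem' := ⟨icosians.zero_mem, by ext <;> simp [conjK]⟩
  add_mem' h h' := ⟨icosians.add_mem h.1 h'.1, by rw [twist_add, h.2, h'.2]⟩
  neg_mem' h := ⟨icosians.neg_mem h.1, by rw [twist_neg, h.2]⟩

/-- The icosians which are mapped to their negative by the twist map. -/
def antiLattice : AddSubgroup ℍ[K] where
  carrier := {q | q ∈ icosians ∧ twist q = -q}
  zero_mem' := ⟨icosians.zero_mem, by ext <;> simp [conjK]⟩
  add_mem' h h' := ⟨icosians.add_mem h.1 h'.1, by rw [twist_add, h.2, h'.2, neg_add]⟩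
  neg_mem' h := ⟨icosians.neg_mem h.1, by rw [twist_neg, h.2]⟩

theorem sqrtFive_smul_mem {q : ℍ[K]} (hq : q ∈ fixedLattice) : sqrtFive • q ∈ antiLattice :=
  ⟨smul_mem_icosians sqrtFive_mem hq.1, by
    rw [twist_smul, hq.2, conjK_sqrtFive]; ext1 <;> simp⟩

theorem intCast_mem_o (n : ℤ) : (n : K) ∈ o := intCast_mem o n

theorem mem_fixedLattice_iff {q : ℍ[K]} : q ∈ fixedLattice ↔
    ∃ a b c k : ℤ, q = icos a b (c - k * tau) (k * sqrtFive) := by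
  constructor
  · rintro ⟨hq, ht⟩
    obtain ⟨x, ⟨a, a', rfl⟩, y, ⟨b, b', rfl⟩, z, ⟨c, c', rfl⟩, w, ⟨d, d', rfl⟩, rfl⟩ :=
      mem_icosians_iff.1 hq
    rw [twist_icos, icos_inj] at ht
    obtain ⟨h1, h2, h3, h4⟩ := ht
    have h1 := congrArg QuadraticAlgebra.im h1
    have h2 := congrArg QuadraticAlgebra.im h2
    have h3 := congrArg QuadraticAlgebra.im h3
    have h4 := congrArg QuadraticAlgebra.re h4
    simp [tau, conjK] at h1 h2 h3 h4
    have e1 : a' = 0 := by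
      have : (a' : ℚ) = 0 := by linarith
      exact_mod_cast this
    have e2 : b' = 0 := by
      have : (b' : ℚ) = 0 := by linarith
      exact_mod_cast this
    have e3 : d' = -2 * d := by
      have : (d' : ℚ) = -2 * d := by linarith
      exact_mod_cast this
    have e4 : c' = d := by
      have : (c' : ℚ) = d := by
        rw [e3] at h3; push_cast at h3; linarith
      exact_mod_cast this
    subst e1 e2 e3 e4
    refine ⟨a, b, c, -c', ?_⟩
    rw [icos_inj, sqrtFive_eq]
    push_cast
    refine ⟨by ring, by ring, by ring, by ring⟩
  · rintro ⟨a, b, c, k, rfl⟩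
    refine ⟨mem_icosians_iff.2 ⟨_, intCast_mem_o _, _, intCast_mem_o _, _,
      o.sub_mem (intCast_mem_o _) (o.mul_mem (intCast_mem_o _) tau_mem), _,
      o.mul_mem (intCast_mem_o _) sqrtFive_mem, rfl⟩, ?_⟩
    rw [twist_icos, icos_inj]
    simp only [conjK_intCast, conjK_sub, conjK_mul, conjK_tau, conjK_sqrtFive]
    simp only [sqrtFive_eq]
    refine ⟨trivial, trivial, by ring, by ring⟩

theorem mem_antiLattice_iff {q : ℍ[K]} : q ∈ antiLattice ↔
    ∃ a b c w : ℤ, q = icos (a * sqrtFive) (b * sqrtFive) (c - (w + 2 * c) * tau) w := by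
  have neg_icos (x y z w : K) : -icos x y z w = icos (-x) (-y) (-z) (-w) := by
    ext1 <;> simp <;> ring
  constructor
  · rintro ⟨hq, ht⟩
    obtain ⟨x, ⟨a, a', rfl⟩, y, ⟨b, b', rfl⟩, z, ⟨c, c', rfl⟩, w, ⟨d, d', rfl⟩, rfl⟩ :=
      mem_icosians_iff.1 hq
    rw [twist_icos, neg_icos, icos_inj] at ht
    obtain ⟨h1, h2, h3, h4⟩ := ht
    have h1 := congrArg QuadraticAlgebra.re h1
    have h2 := congrArg QuadraticAlgebra.re h2
    have h3 := congrArg QuadraticAlgebra.re h3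
    have h4 := congrArg QuadraticAlgebra.im h4
    simp [tau, conjK] at h1 h2 h3 h4
    have e1 : a' = -2 * a := by
      have : (a' : ℚ) = -2 * a := by linarith
      exact_mod_cast this
    have e2 : b' = -2 * b := by
      have : (b' : ℚ) = -2 * b := by linarith
      exact_mod_cast this
    have e3 : d' = 0 := by
      have : (d' : ℚ) = 0 := by linarith
      exact_mod_cast this
    have e4 : c' = -(d + 2 * c) := by
      have : (c' : ℚ) = -(d + 2 * c) := by
        rw [e3] at h3; push_cast at h3; linarith
      exact_mod_cast this
    subst e1 e2 e3 e4
    refine ⟨-a, -b, c, d, ?_⟩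
    rw [icos_inj, sqrtFive_eq]
    push_cast
    refine ⟨by ring, by ring, by ring, by ring⟩
  · rintro ⟨a, b, c, w, rfl⟩
    refine ⟨mem_icosians_iff.2 ⟨_, o.mul_mem (intCast_mem_o _) sqrtFive_mem, _,
      o.mul_mem (intCast_mem_o _) sqrtFive_mem, _,
      ⟨c, -(w + 2 * c), by push_cast; ring⟩, _, intCast_mem_o _, rfl⟩, ?_⟩
    rw [twist_icos, neg_icos, icos_inj]
    have h := conjK_intCast (w + 2 * c)
    push_cast at h
    simp only [conjK_intCast, conjK_sub, conjK_mul, conjK_tau, conjK_sqrtFive, h]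
    refine ⟨by ring, by ring, by ring, trivial⟩

/-- Multiplication by `√5` on `ℍ(K)`. -/
def mulSqrtFive : ℍ[K] →+ ℍ[K] := DistribSMul.toAddMonoidHom ℍ[K] sqrtFive

@[simp] theorem mulSqrtFive_apply (q : ℍ[K]) : mulSqrtFive q = sqrtFive • q := rfl

theorem mulSqrtFive_injective : Function.Injective mulSqrtFive :=
  smul_right_injective _ sqrtFive_ne_zero

/-- In the coordinates of `mem_antiLattice_iff` the sublattice `√5 F` is cut out by `5 ∣ w`; the
homomorphism `f` in the proof reads off `w`. -/
theorem relIndex_map_mulSqrtFive : (fixedLattice.map mulSqrtFive).relIndex antiLattice = 5 := by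
  let f : ℍ[K] →+ ℚ :=
    AddMonoidHom.mk' (fun q => 2 * (q.imK.re - q.imJ.re)) fun p q => by simp; ring
  have hf (x y z w : K) : f (icos x y z w) = w.re := by
    simp [f, half]
  let c : ℤ →+ ℚ := Int.castAddHom ℚ
  have h1 : antiLattice.map f = (⊤ : AddSubgroup ℤ).map c := by
    ext r
    simp only [AddSubgroup.mem_map, AddSubgroup.mem_top, true_and]
    constructor
    · rintro ⟨q, hq, rfl⟩
      obtain ⟨a, b, c', w, rfl⟩ := mem_antiLattice_iff.1 hq
      exact ⟨w, by rw [hf]; simp [c]⟩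
    · rintro ⟨w, rfl⟩
      exact ⟨_, mem_antiLattice_iff.2 ⟨0, 0, 0, w, rfl⟩, by rw [hf]; simp [c]⟩
  have h2 : fixedLattice.map mulSqrtFive ⊓ antiLattice =
      ((AddSubgroup.zmultiples (5 : ℤ)).map c).comap f ⊓ antiLattice := by
    have hs (a b c k : ℤ) : sqrtFive • icos a b (c - k * tau) (k * sqrtFive) =
        icos (a * sqrtFive) (b * sqrtFive) ((-c - 2 * k : ℤ) -
          ((5 * k : ℤ) + 2 * (-c - 2 * k : ℤ)) * tau) (5 * k : ℤ) := by
      have ht := tau_mul_tau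
      have h5 := sqrtFive_mul_self
      rw [sqrtFive_eq] at h5 ⊢
      push_cast
      ext1 <;> simp <;> grind
    ext q
    simp only [AddSubgroup.mem_inf, AddSubgroup.mem_map, AddSubgroup.mem_comap]
    refine and_congr_left fun hq => ⟨?_, ?_⟩
    · rintro ⟨p, hp, rfl⟩
      obtain ⟨a, b, c', k, rfl⟩ := mem_fixedLattice_iff.1 hp
      refine ⟨5 * k, Int.mem_zmultiples_iff.2 ⟨k, rfl⟩, ?_⟩
      rw [mulSqrtFive_apply, hs, hf]
      simp [c]
    · rintro ⟨w', hw', h⟩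
      obtain ⟨a, b, c', w, rfl⟩ := mem_antiLattice_iff.1 hq
      rw [hf] at h
      obtain ⟨k, rfl⟩ := Int.mem_zmultiples_iff.1 hw'
      have hw : w = 5 * k := by
        have : ((5 * k : ℤ) : ℚ) = w := by simpa [c] using h
        exact_mod_cast this.symm
      subst hw
      refine ⟨_, mem_fixedLattice_iff.2 ⟨a, b, -c' - 2 * k, k, rfl⟩, ?_⟩
      rw [mulSqrtFive_apply, hs]
      congr 2 <;> push_cast <;> ring
  rw [← AddSubgroup.inf_relIndex_right, h2, AddSubgroup.inf_relIndex_right,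
    AddSubgroup.relIndex_comap, h1,
    AddSubgroup.relIndex_map_map_of_injective _ _ (f := c) Int.cast_injective,
    AddSubgroup.relIndex_top_right, Int.index_zmultiples]
  rfl

theorem relIndex_dvd_of_le_right {A : Type*} [AddCommGroup A] (H : AddSubgroup A)
    {M M' : AddSubgroup A} (h : M ≤ M') : H.relIndex M ∣ H.relIndex M' := by
  rw [← AddSubgroup.relIndex_addSubgroupOf h]
  exact AddSubgroup.relIndex_dvd_index_of_normal _ _

theorem relIndex_congr {A : Type*} [AddCommGroup A] {H H' M : AddSubgroup A}
    (h : H ⊓ M = H' ⊓ M) : H.relIndex M = H'.relIndex M := by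
  rw [← AddSubgroup.inf_relIndex_right, h, AddSubgroup.inf_relIndex_right]

/-- If `f` were `1` or `25`, then `√5` would be rational; so `f = 5`. -/
theorem eq_of_mul_sq_eq_five_mul_sq {f s ℓ : ℕ} (hf : f ∣ 25) (hℓ : ℓ ≠ 0)
    (h : f * ℓ ^ 2 = 5 * s ^ 2) : s = ℓ := by
  have key {a b : ℕ} (hb : b ≠ 0) (h : a ^ 2 = 5 * b ^ 2) : False := by
    apply fact_five_nonsquare.out ((a : ℚ) / b)
    have hb' : (b : ℚ) ≠ 0 := by exact_mod_cast hb
    field_simp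
    have : (a : ℚ) ^ 2 = 5 * b ^ 2 := by exact_mod_cast h
    linarith
  obtain ⟨i, hi, rfl⟩ := (Nat.dvd_prime_pow (p := 5) (m := 2) (by norm_num)).1 hf
  interval_cases i
  · refine (key (a := ℓ) (b := s) ?_ (by omega)).elim
    rintro rfl
    simp [hℓ] at h
  · exact Nat.pow_left_injective two_ne_zero (by simpa using h.symm)
  · exact (key (a := s) (b := ℓ) hℓ (by omega)).elim

/-- The sum `q + q̃`, as a homomorphism. -/
def addTwist : ℍ[K] →+ ℍ[K] :=
  AddMonoidHom.mk' (fun q => q + twist q) fun p q => by rw [twist_add]; abel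

theorem addTwist_apply (q : ℍ[K]) : addTwist q = q + twist q := rfl

/-- As `τ + τ' = 1`, multiplication by `τ` is a section of `q ↦ q + q̃` over the fixed lattice, so
no factor `2` is lost. -/
theorem addTwist_tau_smul {q : ℍ[K]} (hq : q ∈ fixedLattice) : addTwist (tau • q) = q := by
  rw [addTwist_apply, twist_smul, hq.2, conjK_tau]
  ext1 <;> simp <;> ring

theorem addTwist_mem {q : ℍ[K]} (hq : q ∈ icosians) : addTwist q ∈ fixedLattice :=
  ⟨icosians.add_mem hq (twist_mem hq), by
    rw [addTwist_apply, twist_add, twist_twist, add_comm]⟩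

theorem map_addTwist : icosians.toAddSubgroup.map addTwist = fixedLattice := by
  ext q
  constructor
  · rintro ⟨p, hp, rfl⟩
    exact addTwist_mem hp
  · exact fun hq => ⟨tau • q, smul_mem_icosians tau_mem hq.1, addTwist_tau_smul hq⟩

section

variable {T : ℍ[K] →ₗ[K] ℍ[K]} (hT : ∀ x, T (twist x) = twist (T x))
include hT

/-- The map `x ↦ x + x̃` sends the icosians onto the fixed lattice with kernel the anti-invariant
lattice. It and its section `τ` are compatible with `T`, so the index multiplies along this exact
sequence. -/
theorem relIndex_icosians_eq_mul :
    (icosians.toAddSubgroup.comap T.toAddMonoidHom).relIndex icosians.toAddSubgroup =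
      (icosians.toAddSubgroup.comap T.toAddMonoidHom).relIndex fixedLattice *
        (icosians.toAddSubgroup.comap T.toAddMonoidHom).relIndex antiLattice := by
  set I := icosians.toAddSubgroup with hI
  set J := I.comap T.toAddMonoidHom with hJ
  have hmJ (x) : x ∈ J ↔ T x ∈ icosians := Iff.rfl
  have hmI (x) : x ∈ I ↔ x ∈ icosians := Iff.rfl
  have h1 : (J ⊓ I).relIndex ((J ⊓ I) ⊔ antiLattice) = J.relIndex antiLattice := by
    rw [AddSubgroup.relIndex_sup_left]
    apply relIndex_congr
    have h0 : antiLattice ≤ I := fun x hx => hx.1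
    rw [inf_assoc, inf_eq_right.2 h0]
  have h2 : ((J ⊓ I) ⊔ antiLattice).relIndex I = J.relIndex fixedLattice := by
    have h3 : ((J ⊓ I) ⊔ antiLattice) ⊓ I = J.comap addTwist ⊓ I := by
      ext x
      rw [AddSubgroup.mem_inf, AddSubgroup.mem_inf]
      refine and_congr_left fun hx => ⟨fun h => ?_, fun h => ?_⟩
      · obtain ⟨y, hy, z, hz, rfl⟩ := AddSubgroup.mem_sup.1 h
        rw [AddSubgroup.mem_comap, map_add, addTwist_apply z, hz.2, add_neg_cancel, add_zero,
          hmJ, addTwist_apply, map_add, hT]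
        exact icosians.add_mem hy.1 (twist_mem hy.1)
      · have hf := addTwist_mem hx
        refine AddSubgroup.mem_sup.2 ⟨tau • addTwist x, ⟨?_, ?_⟩, x - tau • addTwist x, ?_, by abel⟩
        · change T (tau • addTwist x) ∈ icosians
          rw [map_smul]
          exact smul_mem_icosians tau_mem h
        · exact smul_mem_icosians tau_mem hf.1
        · refine ⟨icosians.sub_mem hx (smul_mem_icosians tau_mem hf.1), ?_⟩
          rw [eq_neg_iff_add_eq_zero, add_comm, ← addTwist_apply, map_sub, addTwist_tau_smul hf,
            sub_self]
    rw [relIndex_congr h3, AddSubgroup.relIndex_comap, map_addTwist]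
  have h3 : antiLattice ≤ I := fun x hx => hx.1
  rw [← h2, ← h1, mul_comm, AddSubgroup.relIndex_mul_relIndex _ _ _ le_sup_left
    (sup_le inf_le_right h3), AddSubgroup.inf_relIndex_right]

/-- Multiplication by `√5` compares the indices in the two eigenlattices: they differ by a factor `f
/ 5` with `f ∣ 25`, while their product is `ℓ²`. -/
theorem relIndex_fixedLattice {ℓ : ℕ} (hℓ0 : ℓ ≠ 0)
    (hℓ : (icosians.toAddSubgroup.comap T.toAddMonoidHom).relIndex icosians.toAddSubgroup = ℓ ^ 2) :
    (fixedLattice.comap T.toAddMonoidHom).relIndex fixedLattice = ℓ := by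
  rw [relIndex_icosians_eq_mul hT] at hℓ
  set I := icosians.toAddSubgroup with hI
  set J := I.comap T.toAddMonoidHom with hJ
  have hmJ (x) : x ∈ J ↔ T x ∈ icosians := Iff.rfl
  have h1 : fixedLattice.comap T.toAddMonoidHom ⊓ fixedLattice = J ⊓ fixedLattice := by
    ext x
    rw [AddSubgroup.mem_inf, AddSubgroup.mem_inf]
    exact and_congr_left fun hx => ⟨fun h => h.1, fun h => ⟨h, by
      change twist (T x) = T x; rw [← hT, hx.2]⟩⟩
  rw [relIndex_congr h1]
  set W := fixedLattice.map mulSqrtFive with hW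
  set X := J ⊓ antiLattice with hX
  set Y := (J ⊓ fixedLattice).map mulSqrtFive with hY
  have hWm : W ≤ antiLattice := by
    rintro _ ⟨x, hx, rfl⟩; exact sqrtFive_smul_mem hx
  have hYW : Y ≤ W := AddSubgroup.map_mono inf_le_right
  have hYX : Y ≤ X := by
    rintro _ ⟨x, hx, rfl⟩
    refine ⟨?_, sqrtFive_smul_mem hx.2⟩
    change T (sqrtFive • x) ∈ icosians
    rw [map_smul]
    exact smul_mem_icosians sqrtFive_mem hx.1
  have h2 : Y.relIndex antiLattice = J.relIndex fixedLattice * 5 := by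
    rw [← AddSubgroup.relIndex_mul_relIndex _ _ _ hYW hWm, relIndex_map_mulSqrtFive, hY, hW,
      AddSubgroup.relIndex_map_map_of_injective _ _ mulSqrtFive_injective,
      AddSubgroup.inf_relIndex_right]
  have h3 : Y.relIndex X * J.relIndex antiLattice = J.relIndex fixedLattice * 5 := by
    rw [← h2, ← AddSubgroup.relIndex_mul_relIndex _ _ _ hYX inf_le_right, hX,
      AddSubgroup.inf_relIndex_right]
  have h4 : Y = W.comap T.toAddMonoidHom ⊓ W := by
    ext x
    constructor
    · rintro ⟨x, hx, rfl⟩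
      refine ⟨⟨T x, ⟨hx.1, by rw [← hT, hx.2.2]⟩, ?_⟩, x, hx.2, rfl⟩
      exact (map_smul T sqrtFive x).symm
    · rintro ⟨⟨y, hy, hxy⟩, x, hx, rfl⟩
      refine ⟨x, ⟨?_, hx⟩, rfl⟩
      have : mulSqrtFive y = mulSqrtFive (T x) := hxy.trans (map_smul T sqrtFive x)
      change T x ∈ icosians
      rw [← mulSqrtFive_injective this]
      exact hy.1
  -- Membership in `Y` asks for `x ∈ √5 F` and `T x ∈ √5 F`. On `X` both `x` and `T x` lie in the
  -- anti-invariant lattice, so each condition costs a divisor of `5`.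
  have h5 : Y.relIndex X ∣ 25 := by
    rw [h4, ← AddSubgroup.relIndex_inf_mul_relIndex]
    refine (mul_dvd_mul (b := 5) (d := 5) ?_ ?_ : _ ∣ 5 * 5)
    · rw [AddSubgroup.relIndex_comap, ← relIndex_map_mulSqrtFive]
      apply relIndex_dvd_of_le_right
      rintro _ ⟨x, hx, rfl⟩
      refine ⟨hx.2.1, ?_⟩
      change twist (T x) = -T x
      rw [← hT, hx.2.2.2, map_neg]
    · rw [← relIndex_map_mulSqrtFive]
      exact relIndex_dvd_of_le_right _ inf_le_right
  refine eq_of_mul_sq_eq_five_mul_sq h5 hℓ0 ?_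
  rw [← hℓ]
  linear_combination (J.relIndex fixedLattice) * h3

end

/-! ### The rotation `R_q` and its coincidence index -/

/-- The inclusion of `ℍ(K)` into `ℍ`, as a ring homomorphism. -/
noncomputable def toHHom : ℍ[K] →+* ℍ[ℝ] where
  toFun := toH
  map_one' := by ext1 <;> simp [toH, ← toRealHom_apply]
  map_mul' x y := by ext1 <;> simp [toH, ← toRealHom_apply]
  map_zero' := by ext1 <;> simp [toH, ← toRealHom_apply]
  map_add' x y := by ext1 <;> simp [toH, ← toRealHom_apply]

@[simp] theorem toHHom_apply (x : ℍ[K]) : toHHom x = toH x := rfl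

theorem toH_mul (x y : ℍ[K]) : toH (x * y) = toH x * toH y := map_mul toHHom x y

theorem toH_smul (c : K) (x : ℍ[K]) : toH (c • x) = toReal c • toH x := by
  ext1 <;> simp [toH, ← toRealHom_apply]

theorem toH_quat (a b c d : K) :
    toH (quat a b c d) = quat (toReal a) (toReal b) (toReal c) (toReal d) := rfl

theorem toH_injective : Function.Injective toH := by
  intro x y h
  have h0 := congrArg QuaternionAlgebra.re h
  have hi := congrArg QuaternionAlgebra.imI h
  have hj := congrArg QuaternionAlgebra.imJ h
  have hk := congrArg QuaternionAlgebra.imK h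
  ext1
  exacts [toReal_injective h0, toReal_injective hi, toReal_injective hj, toReal_injective hk]

theorem normSq_toH (x : ℍ[K]) : Quaternion.normSq (toH x) = toReal (Quaternion.normSq x) := by
  simp [Quaternion.normSq_def', toH, ← toRealHom_apply]

/-- The four generators of `L` are expressed in icosian coordinates and matched with the
parametrisation of `mem_fixedLattice_iff` by a unimodular change of basis. -/
theorem L_eq_map : L = fixedLattice.map (toHHom : ℍ[K] →+ ℍ[ℝ]) := by
  have hφ : φ = toReal tau := by simp [Real.goldenRatio, toReal, tau]; ring
  have hhalf : toReal half = 1 / 2 := by simp [toReal, half]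
  have h1 : toReal 1 = 1 := map_one toRealHom
  have h0 : toReal 0 = 0 := map_zero toRealHom
  have hn (x : K) : toReal (-x) = -toReal x := map_neg toRealHom x
  have hs : toReal (tau - 1) = toReal tau - 1 := by
    rw [← h1]; exact map_sub toRealHom tau 1
  have h2 := two_mul_half
  have ht := tau_mul_tau
  have g0 : quat (1 : ℝ) 0 0 0 = toH (icos 1 0 0 0) := by
    have : icos 1 0 0 0 = quat 1 0 0 0 := by ext1 <;> simp
    rw [this, toH_quat, h1, h0]
  have g1 : (1 / 2 : ℝ) • quat (-1 : ℝ) 1 1 1 = toH (icos (-1) 0 1 0) := by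
    have : icos (-1) 0 1 0 = half • quat (-1) 1 1 1 := by ext1 <;> simp <;> grind
    rw [this, toH_smul, toH_quat, hhalf, hn, h1]
  have g2 : quat (0 : ℝ) (-1) 0 0 = toH (icos 0 (-1) 0 0) := by
    have : icos 0 (-1) 0 0 = quat 0 (-1) 0 0 := by ext1 <;> simp
    rw [this, toH_quat, hn, h1, h0]
  have g3 : (1 / 2 : ℝ) • quat (0 : ℝ) 1 (φ - 1) (-φ) =
      toH (icos (-1) 2 (tau - 1) (-sqrtFive)) := by
    have : icos (-1) 2 (tau - 1) (-sqrtFive) = half • quat 0 1 (tau - 1) (-tau) := by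
      rw [sqrtFive_eq]
      ext1 <;> simp <;> grind
    rw [this, toH_smul, toH_quat, hhalf, hn, h1, h0, hφ, hs]
  rw [L, g0, g1, g2, g3]
  apply le_antisymm
  · rw [AddSubgroup.closure_le]
    rintro _ (rfl | rfl | rfl | rfl)
    · exact ⟨_, mem_fixedLattice_iff.2 ⟨1, 0, 0, 0, by simp⟩, rfl⟩
    · exact ⟨_, mem_fixedLattice_iff.2 ⟨-1, 0, 1, 0, by simp⟩, rfl⟩
    · exact ⟨_, mem_fixedLattice_iff.2 ⟨0, -1, 0, 0, by simp⟩, rfl⟩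
    · exact ⟨_, mem_fixedLattice_iff.2 ⟨-1, 2, -1, -1, by
        simp; ring_nf⟩, rfl⟩
  · rintro _ ⟨x, hx, rfl⟩
    obtain ⟨a, b, c, k, rfl⟩ := mem_fixedLattice_iff.1 hx
    have e : icos a b (c - k * tau) (k * sqrtFive) = (a + c - k - k) • icos 1 0 0 0 +
        (c - k) • icos (-1) 0 1 0 + -(b + k + k) • icos 0 (-1) 0 0 +
        -k • icos (-1) 2 (tau - 1) (-sqrtFive) := by
      ext1 <;> simp <;> ring
    rw [e]
    simp only [AddMonoidHom.coe_coe, map_add, map_zsmul, toHHom_apply]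
    refine add_mem (add_mem (add_mem ?_ ?_) ?_) ?_ <;>
    exact zsmul_mem (AddSubgroup.subset_closure (by simp)) _

theorem det_eq_det_components (f : ℍ[ℝ] →ₗ[ℝ] ℍ[ℝ]) :
    LinearMap.det f = (Matrix.of fun i j : Fin 4 =>
      ![(f (![quat 1 0 0 0, quat 0 1 0 0, quat 0 0 1 0, quat 0 0 0 1] j)).re,
        (f (![quat 1 0 0 0, quat 0 1 0 0, quat 0 0 1 0, quat 0 0 0 1] j)).imI,
        (f (![quat 1 0 0 0, quat 0 1 0 0, quat 0 0 1 0, quat 0 0 0 1] j)).imJ,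
        (f (![quat 1 0 0 0, quat 0 1 0 0, quat 0 0 1 0, quat 0 0 0 1] j)).imK] i).det := by
  let B : Module.Basis (Fin 4) ℝ ℍ[ℝ] := QuaternionAlgebra.basisOneIJK (-1 : ℝ) 0 (-1)
  have hB (j : Fin 4) :
      B j = ![quat 1 0 0 0, quat 0 1 0 0, quat 0 0 1 0, quat 0 0 0 1] j := by
    apply B.repr.injective
    ext i
    have hr (q : ℍ[ℝ]) : ⇑(B.repr q) = ![q.re, q.imI, q.imJ, q.imK] := rfl
    rw [B.repr_self, hr]
    fin_cases i <;> fin_cases j <;> simp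
  rw [← LinearMap.det_toMatrix B]
  congr 1
  ext i j
  rw [LinearMap.toMatrix_apply, hB]
  rfl

theorem det_mulLeft (a : ℍ[ℝ]) :
    LinearMap.det (LinearMap.mulLeft ℝ a) = Quaternion.normSq a ^ 2 := by
  rw [det_eq_det_components, Quaternion.normSq_def']
  simp [Matrix.det_succ_row_zero, Fin.sum_univ_succ, Fin.succAbove]
  ring

theorem det_mulRight (a : ℍ[ℝ]) :
    LinearMap.det (LinearMap.mulRight ℝ a) = Quaternion.normSq a ^ 2 := by
  rw [det_eq_det_components, Quaternion.normSq_def']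
  simp [Matrix.det_succ_row_zero, Fin.sum_univ_succ, Fin.succAbove]
  ring

theorem exists_rotation {a b : ℍ[ℝ]} (ha : a ≠ 0) (hb : b ≠ 0) :
    ∃ R : ℍ[ℝ] ≃ₗᵢ[ℝ] ℍ[ℝ], (∀ x, R x = ‖a * b‖⁻¹ • (a * x * b)) ∧
      LinearMap.det (R.toLinearEquiv : ℍ[ℝ] →ₗ[ℝ] ℍ[ℝ]) = 1 := by
  let f : ℍ[ℝ] →ₗ[ℝ] ℍ[ℝ] := ‖a * b‖⁻¹ • (LinearMap.mulRight ℝ b ∘ₗ LinearMap.mulLeft ℝ a)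
  have hf (x) : f x = ‖a * b‖⁻¹ • (a * x * b) := rfl
  have ha' : ‖a‖ ≠ 0 := norm_ne_zero_iff.2 ha
  have hb' : ‖b‖ ≠ 0 := norm_ne_zero_iff.2 hb
  let F : ℍ[ℝ] →ₗᵢ[ℝ] ℍ[ℝ] := ⟨f, fun x => by
    rw [hf, norm_smul, norm_inv, norm_norm, norm_mul, norm_mul, norm_mul]
    field_simp⟩
  refine ⟨F.toLinearIsometryEquiv rfl, fun x => rfl, ?_⟩
  change LinearMap.det f = 1
  -- In dimension four the scalar contributes `‖a b‖⁻⁴`, which cancels the determinants `‖a‖⁴` and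
  -- `‖b‖⁴` of the two multiplications.
  rw [LinearMap.det_smul, LinearMap.det_comp, det_mulLeft, det_mulRight,
    Quaternion.finrank_eq_four, Quaternion.normSq_eq_norm_mul_self,
    Quaternion.normSq_eq_norm_mul_self, norm_mul]
  field_simp

theorem mul_smul_mul (c : K) (p x q : ℍ[K]) : p * (c • x) * q = c • (p * x * q) := by
  ext1 <;> simp <;> ring

/-- The map `x ↦ N⁻¹ q̄ x (q̃)⁻`, inverse to `x ↦ N⁻¹ q x q̃` if `|q q̃| = N`. -/
def invRotation (q : ℍ[K]) (N : ℕ) : ℍ[K] →ₗ[K] ℍ[K] where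
  toFun x := (N : K)⁻¹ • (star q * x * star (twist q))
  map_add' x y := by rw [mul_add, add_mul, smul_add]
  map_smul' c x := by
    rw [mul_smul_mul, RingHom.id_apply, smul_smul, smul_smul, mul_comm]

theorem invRotation_apply (q : ℍ[K]) (N : ℕ) (x : ℍ[K]) :
    invRotation q N x = (N : K)⁻¹ • (star q * x * star (twist q)) := rfl

theorem invRotation_twist (q : ℍ[K]) (N : ℕ) (x : ℍ[K]) :
    invRotation q N (twist x) = twist (invRotation q N x) := by
  have : conjK (N : K)⁻¹ = (N : K)⁻¹ := by
    rw [← conjKHom_apply, map_inv₀, map_natCast]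
  rw [invRotation_apply, invRotation_apply, twist_smul, this, twist_mul, twist_mul, twist_star,
    twist_star, twist_twist, mul_assoc]

theorem mul_invRotation_mul {q : ℍ[K]} {N : ℕ} (hN : N ≠ 0)
    (h : Quaternion.normSq q * Quaternion.normSq (twist q) = (N : K) ^ 2) (x : ℍ[K]) :
    q * invRotation q N x * twist q = (N : K) • x := by
  have hN' : (N : K) ≠ 0 := by exact_mod_cast hN
  have h1 : q * (star q * x * star (twist q)) * twist q = (q * star q) * x *
      (star (twist q) * twist q) := by simp only [mul_assoc]
  rw [invRotation_apply, mul_smul_mul, h1, Quaternion.self_mul_star,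
    Quaternion.star_mul_self, mul_assoc, ← Quaternion.coe_commutes, ← mul_assoc,
    ← Quaternion.coe_mul, h, Quaternion.coe_mul_eq_smul, smul_smul]
  congr 1
  field_simp

/-- `R` carries the embedded `T x` to `x`, so `x` lies in `R L` exactly when `T x` lies in the fixed
lattice. This removes the real numbers from the problem. -/
theorem coincidenceIndex_eq {q : ℍ[K]} {N : ℕ} (hN : N ≠ 0)
    (h : Quaternion.normSq q * Quaternion.normSq (twist q) = (N : K) ^ 2)
    (R : ℍ[ℝ] ≃ₗᵢ[ℝ] ℍ[ℝ]) (hR : ∀ x, R x = (N : ℝ)⁻¹ • (toH q * x * toH (twist q))) :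
    coincidenceIndex L R =
      (fixedLattice.comap (invRotation q N).toAddMonoidHom).relIndex fixedLattice := by
  have hRT (x : ℍ[K]) : R (toH (invRotation q N x)) = toH x := by
    have : toReal (N : K) = N := map_natCast toRealHom N
    rw [hR, ← toH_mul, ← toH_mul, mul_invRotation_mul hN h, toH_smul, this,
      inv_smul_smul₀ (by exact_mod_cast hN)]
  rw [coincidenceIndex, csl, AddSubgroup.inf_relIndex_left]
  nth_rw 2 [L_eq_map]
  rw [← AddSubgroup.relIndex_comap]
  congr 1
  ext x
  rw [AddSubgroup.mem_comap, L_eq_map]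
  constructor
  · rintro ⟨_, ⟨y, hy, rfl⟩, hyx⟩
    have h1 : R (toH y) = R (toH (invRotation q N x)) := hyx.trans (hRT x).symm
    change invRotation q N x ∈ fixedLattice
    rwa [← toH_injective (R.injective h1)]
  · exact fun hx => ⟨toH (invRotation q N x), ⟨_, hx, rfl⟩, hRT x⟩

theorem relIndex_comap_invRotation (q : icosians) {N : ℕ} (hN : N ≠ 0)
    (r s : icosianOrder) (hr : (r : ℍ[K]) = star (q : ℍ[K]))
    (hs : (s : ℍ[K]) = star (twist (q : ℍ[K]))) :
    (icosians.toAddSubgroup.comap (invRotation q N).toAddMonoidHom).relIndex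
      icosians.toAddSubgroup = (icosianColon (N : o) r s).index := by
  let ι : icosianOrder →+ ℍ[K] := icosianOrder.subtype.toAddMonoidHom
  have hι : ι.range = icosians.toAddSubgroup := by
    ext x
    exact ⟨by rintro ⟨y, rfl⟩; exact y.2, fun hx => ⟨⟨x, hx⟩, rfl⟩⟩
  have hN' : (N : K) ≠ 0 := by exact_mod_cast hN
  rw [← hι, ← AddSubgroup.index_comap, hι]
  congr 1
  ext x
  rw [mem_icosianColon]
  change (N : K)⁻¹ • (star (q : ℍ[K]) * x * star (twist (q : ℍ[K]))) ∈ icosians ↔ _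
  rw [← hr, ← hs]
  constructor
  · intro h
    refine ⟨⟨_, h⟩, Subtype.ext ?_⟩
    rw [coe_smul]
    exact (smul_inv_smul₀ hN' _).symm
  · rintro ⟨y, hy⟩
    have := congrArg Subtype.val hy
    rw [coe_smul] at this
    simp only [Subalgebra.coe_mul] at this
    rw [this]
    have h2 : (N : K)⁻¹ • (((N : o) : K) • (y : ℍ[K])) = y := inv_smul_smul₀ hN' _
    rw [h2]
    exact y.2

theorem not_dvd_of_isPrimitive {q : icosians} (h : IsPrimitive q) {p : o} (hp : p ≠ 0)
    (hp' : ¬ IsUnit p) : ¬ ∃ y ∈ icosians, (q : ℍ[K]) = (p : K) • y := by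
  rintro ⟨y, hy, hq⟩
  have hp0 : (p : K) ≠ 0 := fun h0 => hp (Subtype.ext h0)
  have h1 := h (p : K)⁻¹ (by rw [hq, inv_smul_smul₀ hp0]; exact hy)
  exact hp' (IsUnit.of_mul_eq_one ⟨_, h1⟩ (Subtype.ext (mul_inv_cancel₀ hp0)))

theorem ne_zero_of_isPrimitive {q : icosians} (h : IsPrimitive q) : (q : ℍ[K]) ≠ 0 := by
  intro h0
  -- If `q` were zero then every scalar would have to lie in `ℤ[τ]`, which fails for `1/2`.
  obtain ⟨m, n, hmn⟩ := h half (by rw [h0, smul_zero]; exact icosians.zero_mem)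
  have hi := congrArg QuadraticAlgebra.im hmn
  have hr := congrArg QuadraticAlgebra.re hmn
  simp [half, tau] at hi hr
  rw [hi] at hr
  have : (2 * m : ℚ) = 1 := by push_cast at hr; linarith
  have : 2 * m = 1 := by exact_mod_cast this
  omega

end Icosian

/-! ### The coincidence index of `R_q` -/

open Icosian in
theorem mainTheorem3 (q : icosians) (hprim : IsPrimitive q) (hadm : IsAdmissible q) :
    -- the map `x ↦ q x q̃ / |q q̃|` is a rotation, and a coincidence isometry of `L`
    ∃ R : ℍ[ℝ] ≃ₗᵢ[ℝ] ℍ[ℝ],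
      (∀ x : ℍ[ℝ], R x = ‖toH (q * twist q)‖⁻¹ • (toH q * x * toH (twist q))) ∧
      LinearMap.det (R.toLinearEquiv : ℍ[ℝ] →ₗ[ℝ] ℍ[ℝ]) = 1 ∧
      IsCoincidenceIsometry L R ∧
      -- `nr(q)` and `nr(q)'` have exactly one least common multiple that is a natural number,
      (∃! ℓ : ℕ, IsLcm (nr q) (conjO (nr q)) (ℓ : o)) ∧
      ∀ ℓ : ℕ, IsLcm (nr q) (conjO (nr q)) (ℓ : o) →
        -- with it, `α = √(lcm(nr(q), nr(q)') / nr(q))` lies in `ℤ[τ]`,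
        (∃ α : o, IsExtensionFactor q ℓ α) ∧
        ∀ α : o, IsExtensionFactor q ℓ α →
          -- and the coincidence index is `nr(α q) = lcm(nr(q), nr(q)')`
          (coincidenceIndex L R : o) = nr (extension q α) ∧
          coincidenceIndex L R = ℓ := by
  have hq0 := ne_zero_of_isPrimitive hprim
  have ha0 : toH q ≠ 0 := fun h => hq0 (toH_injective (h.trans (map_zero toHHom).symm))
  have hb0 : toH (twist q) ≠ 0 := fun h => by
    have h1 : twist (q : ℍ[K]) = 0 := toH_injective (h.trans (map_zero toHHom).symm)
    apply hq0
    rw [← twist_twist (q : ℍ[K]), h1]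
    ext <;> simp [conjK]
  obtain ⟨R, hR, hdet⟩ := exists_rotation ha0 hb0
  rw [← toH_mul] at hR
  obtain ⟨N, hN⟩ := hadm
  have hpos : 0 < toReal (nr q) := by
    change 0 < toReal (Quaternion.normSq (q : ℍ[K]))
    rw [← normSq_toH]
    exact lt_of_le_of_ne Quaternion.normSq_nonneg (Ne.symm (Quaternion.normSq_ne_zero.2 ha0))
  have hpos' : 0 < toReal (conjK (nr q)) := by
    change 0 < toReal (conjK (Quaternion.normSq (q : ℍ[K])))
    rw [← normSq_twist, ← normSq_toH]
    exact lt_of_le_of_ne Quaternion.normSq_nonneg (Ne.symm (Quaternion.normSq_ne_zero.2 hb0))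
  have hN0 : N ≠ 0 := by
    rintro rfl
    rw [toH_mul, Nat.cast_zero, norm_eq_zero] at hN
    exact (mul_ne_zero ha0 hb0) hN
  have hNK : Quaternion.normSq (q : ℍ[K]) * Quaternion.normSq (twist (q : ℍ[K])) = (N : K) ^ 2 := by
    apply toReal_injective
    rw [← map_mul, ← normSq_toH, Quaternion.normSq_eq_norm_mul_self, hN, ← sq]
    exact ((map_pow toRealHom _ 2).trans (by rw [map_natCast])).symm
  have hNo : nr q * conjHom (nr q) = ((N : ℤ) : o) ^ 2 := by
    apply Subtype.ext
    rw [normSq_twist] at hNK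
    push_cast
    exact hNK
  have hm0 : nr q ≠ 0 := fun h => by
    rw [h] at hpos; simp [toReal] at hpos
  let q' : icosianOrder := ⟨q, q.2⟩
  let r : icosianOrder := conj q'
  let s : icosianOrder := conj ⟨twist q, twist_mem q.2⟩
  have hrn : rnorm r = nr q := rnorm_conj q'
  have hsn : rnorm s = conjHom (nr q) := by
    rw [rnorm_conj]; exact Subtype.ext (normSq_twist _)
  have hr (p : o) (hp : Prime p) : ¬ ∃ y, r = p • y := by
    rintro ⟨y, hy⟩
    refine not_dvd_of_isPrimitive hprim hp.ne_zero hp.not_isUnit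
      ⟨star (y : ℍ[K]), star_mem_icosians y.2, ?_⟩
    have := congrArg (fun x : icosianOrder => star (x : ℍ[K])) hy
    simpa [r, q', coe_o_smul] using this
  have hs (p : o) (hp : Prime p) : ¬ ∃ y, s = p • y := by
    rintro ⟨y, hy⟩
    have hp' : ¬ IsUnit (conjHom p) := fun h => hp.not_isUnit (by simpa using h.map conjHom)
    refine not_dvd_of_isPrimitive hprim (conjHom_ne_zero hp.ne_zero) hp' ⟨twist (star (y : ℍ[K])),
      twist_mem (star_mem_icosians y.2), ?_⟩
    have := congrArg (fun x : icosianOrder => twist (star (x : ℍ[K]))) hy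
    simpa [s, coe_o_smul, twist_smul] using this
  have hne (ℓ : ℕ) (hℓ : IsLcm (nr q) (conjHom (nr q)) (ℓ : o)) : ℓ ≠ 0 := by
    rintro rfl
    exact hℓ.ne_zero hm0 (conjHom_ne_zero hm0) Nat.cast_zero
  have hindex (ℓ : ℕ) (hℓ : IsLcm (nr q) (conjO (nr q)) (ℓ : o)) : coincidenceIndex L R = ℓ := by
    rw [conjO_eq] at hℓ
    rw [coincidenceIndex_eq hN0 hNK R (by rwa [hN] at hR)]
    refine relIndex_fixedLattice (invRotation_twist _ _) (hne ℓ hℓ) ?_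
    rw [relIndex_comap_invRotation q hN0 r s rfl rfl]
    have := index_icosianColon_eq_sq (r := r) (s := s) (N := N) (ℓ := ℓ) (by exact_mod_cast hN0)
      (by rwa [hrn]) (by rw [hsn, hrn]) (by rw [hrn, hNo]) hr hs (by rwa [hrn])
    simpa using this
  have hex := existsUnique_natCast_isLcm hm0 hNo
  refine ⟨R, hR, hdet, ?_, hex, fun ℓ hℓ => ?_⟩
  · obtain ⟨ℓ, hℓ, -⟩ := hex
    refine ⟨?_⟩
    -- `relIndex` takes the value `0` for an infinite index, so `ℓ ≠ 0` yields finiteness.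
    have := hindex ℓ hℓ
    rw [coincidenceIndex] at this
    rw [this]
    exact hne ℓ hℓ
  · obtain ⟨β, hβ, hβ0⟩ := exists_mul_sq_eq_lcm hm0 hpos hpos' hNo hℓ
    have hβ' : IsExtensionFactor q ℓ β := by
      have h1 : toReal (nr q) * toReal β ^ 2 = ℓ := by
        have := congrArg (toRealHom.comp o.subtype) hβ
        simp only [map_mul, map_pow, map_natCast] at this
        exact this
      rw [IsExtensionFactor, ← h1, mul_div_cancel_left₀ _ hpos.ne', Real.sqrt_sq hβ0]
    refine ⟨⟨β, hβ'⟩, fun α hα => ⟨?_, hindex ℓ hℓ⟩⟩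
    have hαβ : α = β := Subtype.ext (toReal_injective (hα.trans hβ'.symm))
    rw [hindex ℓ hℓ, hαβ, ← hβ]
    apply Subtype.ext
    change _ = Quaternion.normSq ((β : K) • (q : ℍ[K]))
    rw [Quaternion.normSq_smul]
    change Quaternion.normSq (q : ℍ[K]) * (β : K) ^ 2 = _
    ring
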